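/- For a graph $G$, a bond percolation model on $G$ is a probability distribution on the spanning subgraphs of $G$ (each edge being open, i.e. present, or closed). It is 1-independent if, for any two sets $S_1,S_2$ of edges of $G$ such that no edge of $S_1$ shares a vertex with an edge of $S_2$, the states of the edges in $S_1$ are independent of the states of the edges in $S_2$. It percolates if the random subgraph has an infinite component with positive probability. Let $\mathcal D_{\ge p}(G)$ be the class of 1-independent bond percolation models on $G$ in which each edge is open with probability at least $p$, and let $$p_{\max}(G)=\sup\{p\in[0,1] : \text{some model in } \mathcal D_{\ge p}(G) \text{ does not percolate}\}.$$ Let $Q_k$ be the $k$-dimensional hypercube graph, with vertex set $\{0,1\}^k$ and edges between vertices that differ in exactly one coordinate, and let $\mathbb Z^n$ be the $n$-dimensional integer lattice graph, with edges between vertices at Euclidean distance $1$. Theorem 1.4. Let $p\in(0,1]$, let $k\ge 1$ be an integer, and let $P>(1-p)^{2^{k-1}}\varphi$ be a real number, where $\varphi=\frac12(\sqrt5+1)$ is the golden ratio. Suppose that for every model in $\mathcal D_{\ge p}(Q_k)$ the probability that the random subgraph is connected is at least $P$. Then there is an $N$ such that for all $n\ge N$ every model in $\mathcal D_{\ge p}(\mathbb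 Z^n)$ percolates. In particular, the limit $\lim_{n\to\infty}p_{\max}(\mathbb Z^n)$ exists and $$\lim_{n\to\infty}p_{\max}(\mathbb Z^n)\le p.$$ -/

import Mathlib

open MeasureTheory ProbabilityTheory Filter Topology

namespace Percolation

/-- An edge configuration of `G`: each edge is open (`true`) or closed (`false`). It encodes a
spanning subgraph of `G`, and carries the product `σ`-algebra. -/
abbrev Config {V : Type*} (G : SimpleGraph V) : Type _ := G.edgeSet → Bool

/-- The spanning subgraph of `G` formed by the open edges of `ω`. -/
def openGraph {V : Type*} {G : SimpleGraph V} (ω : Config G) : SimpleGraph V where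
  Adj u v := ∃ h : G.Adj u v, ω ⟨s(u, v), h⟩ = true
  symm := ⟨by
    rintro u v ⟨h, hω⟩
    refine ⟨h.symm, ?_⟩
    have e : (⟨s(v, u), h.symm⟩ : G.edgeSet) = ⟨s(u, v), h⟩ := Subtype.ext Sym2.eq_swap
    rw [e]
    exact hω⟩
  loopless := ⟨fun u hu => G.loopless.irrefl u hu.1⟩

/-- Two sets of edges such that no edge of the first shares a vertex with an edge of the second. -/
def VertexDisjoint {V : Type*} {G : SimpleGraph V} (S₁ S₂ : Set G.edgeSet) : Prop :=
  ∀ e ∈ S₁, ∀ f ∈ S₂, ∀ v : V, v ∈ (e : Sym2 V) → v ∉ (f : Sym2 V)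

/-- 1-independence: the states of the edges of `S₁` are independent of the states of the edges
of `S₂` whenever `S₁` and `S₂` are vertex-disjoint sets of edges. -/
def OneIndependent {V : Type*} (G : SimpleGraph V) (μ : Measure (Config G)) : Prop :=
  ∀ S₁ S₂ : Set G.edgeSet, VertexDisjoint S₁ S₂ →
    IndepFun (fun (ω : Config G) (e : S₁) => ω e) (fun (ω : Config G) (e : S₂) => ω e) μ

/-- The class `𝒟_{≥p}(G)` of 1-independent bond percolation models on `G` in which each edge is
open with probability at least `p`. -/
def DGe {V : Type*} (G : SimpleGraph V) (p : ℝ) : Set (Measure (Config G)) :=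
  {μ | IsProbabilityMeasure μ ∧ OneIndependent G μ ∧
    ∀ e : G.edgeSet, p ≤ μ.real {ω | ω e = true}}

/-- The open subgraph has an infinite component with positive probability. -/
def Percolates {V : Type*} {G : SimpleGraph V} (μ : Measure (Config G)) : Prop :=
  0 < μ {ω | ∃ C : (openGraph ω).ConnectedComponent, C.supp.Infinite}

/-- The supremum of those probabilities `p` for which some model in `𝒟_{≥p}(G)` does not
percolate. -/
noncomputable def pMax {V : Type*} (G : SimpleGraph V) : ℝ :=
  sSup {p : ℝ | p ∈ Set.Icc 0 1 ∧ ∃ μ ∈ DGe G p, ¬ Percolates μ}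

/-- The hypercube graph `Q_n`: vertices of `{0,1}^n` are adjacent iff they differ in exactly one
coordinate. -/
def cube (n : ℕ) : SimpleGraph (Fin n → Bool) where
  Adj x y := ∃! i, x i ≠ y i
  symm := ⟨fun x y h => by simpa only [ne_comm] using h⟩
  loopless := ⟨fun x h => by obtain ⟨i, hi, -⟩ := h; exact hi rfl⟩

/-- The lattice graph `ℤ^n`: vertices are adjacent iff they differ by exactly `1` in one
coordinate and agree in all the others. -/
def lattice (n : ℕ) : SimpleGraph (Fin n → ℤ) where
  Adj x y := ∃ i, |x i - y i| = 1 ∧ ∀ j, j ≠ i → x j = y j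
  symm := ⟨fun x y ⟨i, hi, h⟩ => ⟨i, by rw [abs_sub_comm]; exact hi, fun j hj => (h j hj).symm⟩⟩
  loopless := ⟨fun x ⟨i, hi, _⟩ => by simp at hi⟩

end Percolation

/-!
If both facets of `Q_{k+1}` that are copies of `Q_k` are connected, then `Q_{k+1}` is disconnected
only if all `2 ^ k` edges between them are closed. So the least connection probabilities satisfy
`P_{k+1} ≥ P_k ^ 2 - (1 - p) ^ 2 ^ k`, and the ratio `x_k = P_k / (1 - p) ^ 2 ^ (k - 1)` satisfies
`x_{k+1} ≥ x_k ^ 2 - 1`. The positive fixed point of `x ↦ x ^ 2 - 1` is the golden ratio, so above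
it the ratio tends to infinity: for large `k`, two adjacent copies of `Q_k` that are both connected
are very likely joined by an open edge.

For large `n`, the lattice `ℤ ^ n` contains `ℤ ^ 2 □ T □ Q_k` with `T` a product of two large stars.
Over each point of `ℤ ^ 2` a leaf of the first star with a connected copy of `Q_k` is selected, and
neighbouring selected copies are joined, with high probability, through one of the many leaves of
the second star. This gives a 1-independent model on `ℤ ^ 2` with edge probability close to `1`.
Grouping the points into `2 × 2` blocks turns a probability `ε` for an edge to be closed into at
most `(36 ε) ^ 2`, so iterating this renormalization yields an infinite component.
-/

open scoped SimpleGraph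

namespace Percolation

variable {V W : Type*} {G : SimpleGraph V} {H : SimpleGraph W} {μ : Measure (Config G)}
  {p q : ℝ}

/-- The edges of `G` both of whose endpoints lie in `R`. -/
def edgesWithin (G : SimpleGraph V) (R : Set V) : Set G.edgeSet :=
  {e | ∀ v ∈ (e : Sym2 V), v ∈ R}

/-- The `σ`-algebra of the events that depend only on the states of the edges within `R`. -/
abbrev edgeEvents (G : SimpleGraph V) (R : Set V) : MeasurableSpace (Config G) :=
  cylinderEvents (edgesWithin G R)

lemma edgeEvents_mono {R S : Set V} (h : R ⊆ S) : edgeEvents G R ≤ edgeEvents G S :=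
  cylinderEvents_mono fun _ he v hv ↦ h (he v hv)

lemma edgeEvents_le (R : Set V) : edgeEvents G R ≤ MeasurableSpace.pi :=
  cylinderEvents_le_pi

lemma measurable_apply_edgeEvents {R : Set V} {e : G.edgeSet} (he : e ∈ edgesWithin G R) :
    Measurable[edgeEvents G R] fun ω : Config G ↦ ω e :=
  measurable_cylinderEvent_apply he

lemma OneIndependent.indep (h : OneIndependent G μ) {R S : Set V} (hRS : Disjoint R S) :
    Indep (edgeEvents G R) (edgeEvents G S) μ := by
  have restrict_comap (T : Set V) : edgeEvents G T ≤ MeasurableSpace.comap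
      (fun (ω : Config G) (e : edgesWithin G T) ↦ ω e) MeasurableSpace.pi :=
    iSup₂_le fun e he ↦ Measurable.comap_le <|
      (measurable_pi_apply (⟨e, he⟩ : edgesWithin G T)).comp
        (comap_measurable fun (ω : Config G) (e : edgesWithin G T) ↦ ω e)
  have hdisj : VertexDisjoint (edgesWithin G R) (edgesWithin G S) :=
    fun e he f hf v hve hvf ↦ hRS.le_bot ⟨he v hve, hf v hvf⟩
  exact indep_of_indep_of_le ((IndepFun_iff_Indep _ _ _).mp (h _ _ hdisj))
    (restrict_comap R) (restrict_comap S)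

lemma OneIndependent.iIndep [IsProbabilityMeasure μ] (h : OneIndependent G μ) {ι : Type*}
    {R : ι → Set V} (hR : Pairwise (Function.onFun Disjoint R)) :
    iIndep (fun i ↦ edgeEvents G (R i)) μ := by
  classical
  refine (iIndep_iff _ _).mpr fun s ↦ ?_
  induction s using Finset.induction_on with
  | empty => simp
  | insert a s ha ih =>
    intro A hA
    have hs : MeasurableSet[edgeEvents G (⋃ i ∈ s, R i)] (⋂ i ∈ s, A i) :=
      Finset.measurableSet_biInter s fun i hi ↦
        edgeEvents_mono (Set.subset_biUnion_of_mem hi) _ (hA i (Finset.mem_insert_of_mem hi))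
    have hdisj : Disjoint (R a) (⋃ i ∈ s, R i) :=
      Set.disjoint_iUnion₂_right.mpr fun i hi ↦ hR (ne_of_mem_of_not_mem hi ha).symm
    rw [Finset.set_biInter_insert, Finset.prod_insert ha,
      (Indep_iff _ _ _).mp (h.indep hdisj) _ _ (hA a (Finset.mem_insert_self a s)) hs,
      ih fun i hi ↦ hA i (Finset.mem_insert_of_mem hi)]

lemma OneIndependent.measureReal_inter (h : OneIndependent G μ) {R S : Set V}
    (hRS : Disjoint R S) {A B : Set (Config G)} (hA : MeasurableSet[edgeEvents G R] A)
    (hB : MeasurableSet[edgeEvents G S] B) : μ.real (A ∩ B) = μ.real A * μ.real B := by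
  simp only [measureReal_def, (Indep_iff _ _ _).mp (h.indep hRS) A B hA hB, ENNReal.toReal_mul]

lemma OneIndependent.measureReal_biInter [IsProbabilityMeasure μ] (h : OneIndependent G μ)
    {ι : Type*} {R : ι → Set V} (hR : Pairwise (Function.onFun Disjoint R)) (s : Finset ι)
    {A : ι → Set (Config G)} (hA : ∀ i, MeasurableSet[edgeEvents G (R i)] (A i)) :
    μ.real (⋂ i ∈ s, A i) = ∏ i ∈ s, μ.real (A i) := by
  simp only [measureReal_def, (h.iIndep hR).meas_biInter fun i _ ↦ hA i, ENNReal.toReal_prod]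

lemma measurableSet_open (e : G.edgeSet) : MeasurableSet {ω : Config G | ω e = true} :=
  measurableSet_eq_fun (measurable_pi_apply e) measurable_const

lemma measureReal_closed_le (hμ : μ ∈ DGe G p) (e : G.edgeSet) :
    μ.real {ω | ω e = false} ≤ 1 - p := by
  have := hμ.1
  have hcompl : {ω : Config G | ω e = false} = {ω | ω e = true}ᶜ := by
    ext ω
    simp
  rw [hcompl, probReal_compl_eq_one_sub (measurableSet_open e)]
  exact sub_le_sub_left (hμ.2.2 e) 1

/-- A map of configurations is local if the state it assigns to an edge is determined by the
edges within regions attached to the two endpoints, where distinct vertices have disjoint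
regions. Such maps preserve 1-independence. -/
structure IsLocal (F : Config G → Config H) (R : W → Set V) : Prop where
  disjoint : Pairwise (Function.onFun Disjoint R)
  measurable_apply (e : H.edgeSet) :
    Measurable[edgeEvents G (⋃ v ∈ (e : Sym2 W), R v)] fun ω ↦ F ω e

namespace IsLocal

variable {F : Config G → Config H} {R : W → Set V}

lemma measurable (hF : IsLocal F R) : Measurable F :=
  measurable_pi_iff.mpr fun e ↦ (hF.measurable_apply e).mono (edgeEvents_le _) le_rfl

lemma oneIndependent_map (hF : IsLocal F R) (hμ : OneIndependent G μ) :
    OneIndependent H (μ.map F) := by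
  intro S₁ S₂ hS
  let U (S : Set H.edgeSet) : Set V := ⋃ e ∈ S, ⋃ v ∈ (e : Sym2 W), R v
  have hU : Disjoint (U S₁) (U S₂) := by
    simp only [U, Set.disjoint_iUnion_left, Set.disjoint_iUnion_right]
    exact fun e he v hv f hf w hw ↦ hF.disjoint fun hvw ↦ hS f hf e he w hw (hvw ▸ hv)
  have hle (S : Set H.edgeSet) :
      MeasurableSpace.comap (fun ω (e : S) ↦ F ω e) MeasurableSpace.pi ≤ edgeEvents G (U S) :=
    Measurable.comap_le <| @measurable_pi_lambda _ _ _ (_) _ _ fun e ↦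
      (hF.measurable_apply e).mono (edgeEvents_mono
        (Set.subset_biUnion_of_mem (u := fun e : H.edgeSet ↦ ⋃ v ∈ (e : Sym2 W), R v) e.2)) le_rfl
  have hindep : IndepFun (fun ω (e : S₁) ↦ F ω e) (fun ω (e : S₂) ↦ F ω e) μ :=
    (IndepFun_iff_Indep _ _ _).mpr (indep_of_indep_of_le (hμ.indep hU) (hle S₁) (hle S₂))
  rw [indepFun_iff_measure_inter_preimage_eq_mul] at hindep ⊢
  intro A B hA hB
  have hrestrict (S : Set H.edgeSet) : Measurable fun (ω : Config H) (e : S) ↦ ω e := by fun_prop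
  have hA' := hrestrict S₁ hA
  have hB' := hrestrict S₂ hB
  rw [Measure.map_apply hF.measurable (hA'.inter hB'), Measure.map_apply hF.measurable hA',
    Measure.map_apply hF.measurable hB']
  exact hindep A B hA hB

lemma map_mem_DGe (hF : IsLocal F R) (hμ : μ ∈ DGe G p)
    (hq : ∀ e : H.edgeSet, q ≤ μ.real {ω | F ω e = true}) : μ.map F ∈ DGe H q := by
  obtain ⟨_, hindep, -⟩ := hμ
  refine ⟨Measure.isProbabilityMeasure_map hF.measurable.aemeasurable,
    hF.oneIndependent_map hindep, fun e ↦ ?_⟩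
  rw [map_measureReal_apply hF.measurable (measurableSet_open e)]
  exact hq e

end IsLocal

lemma openGraph_adj_iff {ω : Config G} {u v : V} (h : G.Adj u v) :
    (openGraph ω).Adj u v ↔ ω ⟨s(u, v), h⟩ = true :=
  ⟨fun ⟨_, hω⟩ ↦ hω, fun hω ↦ ⟨h, hω⟩⟩

section Pull

variable {U : Type*} {A : SimpleGraph U}

/-- The configuration on `A` obtained by reading off the states of the images of its edges. -/
def pull (φ : A →g G) (ω : Config G) : Config A := fun e ↦ ω (φ.mapEdgeSet e)

lemma openGraph_pull_adj_iff {φ : A →g G} {ω : Config G} {u v : U} :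
    (openGraph (pull φ ω)).Adj u v ↔ A.Adj u v ∧ (openGraph ω).Adj (φ u) (φ v) :=
  ⟨fun ⟨h, hω⟩ ↦ ⟨h, φ.map_adj h, hω⟩, fun ⟨h, _, hω⟩ ↦ ⟨h, hω⟩⟩

/-- A homomorphism `φ : A →g G`, as a homomorphism from the open subgraph pulled back along `φ`
to the open subgraph. -/
def openHom (φ : A →g G) (ω : Config G) : openGraph (pull φ ω) →g openGraph ω :=
  ⟨φ, fun h ↦ (openGraph_pull_adj_iff.mp h).2⟩

lemma mapEdgeSet_mem_edgesWithin (φ : A →g G) {R : Set V} {e : A.edgeSet}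
    (h : ∀ u ∈ (e : Sym2 U), φ u ∈ R) : φ.mapEdgeSet e ∈ edgesWithin G R := by
  intro v hv
  obtain ⟨u, hu, rfl⟩ := Sym2.mem_map.mp hv
  exact h u hu

lemma measurable_pull_edgeEvents (φ : A →g G) :
    Measurable[edgeEvents G (Set.range φ)] (pull φ) :=
  @measurable_pi_lambda _ _ _ (_) _ _ fun _ ↦
    measurable_apply_edgeEvents (mapEdgeSet_mem_edgesWithin φ fun u _ ↦ ⟨u, rfl⟩)

lemma isLocal_pull {φ : A →g G} (hφ : Function.Injective φ) :
    IsLocal (pull φ) fun v ↦ {φ v} where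
  disjoint _ _ h := Set.disjoint_singleton.mpr (hφ.ne h)
  measurable_apply _ := measurable_apply_edgeEvents <|
    mapEdgeSet_mem_edgesWithin φ fun _ hu ↦ Set.mem_biUnion hu rfl

lemma map_pull_mem_DGe {φ : A →g G} (hφ : Function.Injective φ) (hμ : μ ∈ DGe G p) :
    μ.map (pull φ) ∈ DGe A p :=
  (isLocal_pull hφ).map_mem_DGe hμ fun e ↦ hμ.2.2 (φ.mapEdgeSet e)

/-- The product of two homomorphisms, on the box products. -/
def boxProdMap {A B : Type*} {K : SimpleGraph A} {L : SimpleGraph B} (φ : K →g G) (ψ : L →g H) :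
    (K □ L) →g (G □ H) where
  toFun := Prod.map φ ψ
  map_rel' h := h.imp (.imp φ.map_adj (congrArg ψ)) (.imp ψ.map_adj (congrArg φ))

lemma pull_pull {A B : Type*} {K : SimpleGraph A} {L : SimpleGraph B} (φ : K →g G) (ψ : L →g K)
    (ω : Config G) : pull ψ (pull φ ω) = pull (φ.comp ψ) ω :=
  funext fun _ ↦ congrArg ω (Subtype.ext (Sym2.map_map _))

end Pull

section InfiniteComponent

lemma measurableSet_adj {R : Set V} {u v : V} (hu : u ∈ R) (hv : v ∈ R) :
    MeasurableSet[edgeEvents G R] {ω | (openGraph ω).Adj u v} := by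
  by_cases h : G.Adj u v
  · have he : (⟨s(u, v), h⟩ : G.edgeSet) ∈ edgesWithin G R := by
      simp [edgesWithin, hu, hv]
    simp only [openGraph_adj_iff h]
    exact measurable_apply_edgeEvents he (measurableSet_singleton true)
  · simp only [openGraph, h, IsEmpty.exists_iff, Set.ofPred_false, MeasurableSet.empty]

lemma measurableSet_exists_walk [Countable V] (n : ℕ) (u v : V) :
    MeasurableSet {ω : Config G | ∃ w : (openGraph ω).Walk u v, w.length = n} := by
  induction n generalizing u with
  | zero => simp only [SimpleGraph.Walk.exists_length_eq_zero_iff, MeasurableSet.const]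
  | succ n ih =>
    have hsucc : {ω : Config G | ∃ w : (openGraph ω).Walk u v, w.length = n + 1} =
        ⋃ x, {ω | (openGraph ω).Adj u x} ∩
          {ω | ∃ w : (openGraph ω).Walk x v, w.length = n} := by
      ext ω
      simp only [Set.mem_ofPred_eq, Set.mem_iUnion, Set.mem_inter_iff]
      constructor
      · rintro ⟨_ | ⟨h, w⟩, hw⟩
        · simp at hw
        · exact ⟨_, h, w, by simpa using hw⟩
      · rintro ⟨x, h, w, hw⟩
        exact ⟨.cons h w, by simp [hw]⟩
    rw [hsucc]
    exact .iUnion fun x ↦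
      (edgeEvents_le _ _ (measurableSet_adj (Set.mem_univ u) (Set.mem_univ x))).inter (ih x)

lemma measurableSet_reachable [Countable V] (u v : V) :
    MeasurableSet {ω : Config G | (openGraph ω).Reachable u v} := by
  have hunion : {ω : Config G | (openGraph ω).Reachable u v} =
      ⋃ n, {ω | ∃ w : (openGraph ω).Walk u v, w.length = n} := by
    ext ω
    simp only [Set.mem_iUnion, Set.mem_ofPred_eq]
    exact ⟨fun ⟨w⟩ ↦ ⟨w.length, w, rfl⟩, fun ⟨_, w, _⟩ ↦ ⟨w⟩⟩
  rw [hunion]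
  exact .iUnion fun n ↦ measurableSet_exists_walk n u v

lemma reachable_map_of_forall_adj {f : V → W}
    (hadj : ∀ u v, G.Adj u v → H.Reachable (f u) (f v)) {u v : V} (h : G.Reachable u v) :
    H.Reachable (f u) (f v) := by
  obtain ⟨w⟩ := h
  induction w with
  | nil => exact .refl _
  | cons h _ ih => exact (hadj _ _ h).trans ih

/-- The graph has an infinite connected component. -/
def HasInfiniteComponent (G : SimpleGraph V) : Prop :=
  ∃ C : G.ConnectedComponent, C.supp.Infinite

lemma hasInfiniteComponent_iff :
    HasInfiniteComponent G ↔ ∃ u, {v | G.Reachable u v}.Infinite := by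
  have hsupp (u : V) : (G.connectedComponentMk u).supp = {v | G.Reachable u v} := by
    ext v
    simp [SimpleGraph.ConnectedComponent.mem_supp_iff, SimpleGraph.reachable_comm]
  simp only [HasInfiniteComponent, SimpleGraph.ConnectedComponent.exists, hsupp]

lemma HasInfiniteComponent.of_injective (hG : HasInfiniteComponent G) {f : V → W}
    (hf : Function.Injective f) (hadj : ∀ u v, G.Adj u v → H.Reachable (f u) (f v)) :
    HasInfiniteComponent H := by
  obtain ⟨u, hu⟩ := hasInfiniteComponent_iff.mp hG
  refine hasInfiniteComponent_iff.mpr ⟨f u, (hu.image hf.injOn).mono ?_⟩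
  rintro _ ⟨v, hv, rfl⟩
  exact reachable_map_of_forall_adj hadj hv

lemma measurableSet_hasInfiniteComponent [Countable V] :
    MeasurableSet {ω : Config G | HasInfiniteComponent (openGraph ω)} := by
  have hexhaust (S : Set V) : S.Infinite ↔ ∀ T : Finset V, ∃ v, v ∉ T ∧ v ∈ S :=
    ⟨fun h T ↦ (h.exists_notMem_finset T).imp fun _ ↦ And.symm,
      fun h hS ↦ by
        obtain ⟨v, hv, hvS⟩ := h hS.toFinset
        exact hv (hS.mem_toFinset.mpr hvS)⟩
  simp only [hasInfiniteComponent_iff, hexhaust, Set.ofPred_exists, Set.ofPred_forall]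
  exact .iUnion fun u ↦ .iInter fun T ↦ .iUnion fun v ↦
    (MeasurableSet.const _).inter (measurableSet_reachable u v)

lemma Percolates.of_map [Countable W] {F : Config G → Config H} (hF : Measurable F)
    (h : ∀ ω, HasInfiniteComponent (openGraph (F ω)) → HasInfiniteComponent (openGraph ω))
    (hμ : Percolates (μ.map F)) : Percolates μ := by
  calc 0 < μ.map F {ω | HasInfiniteComponent (openGraph ω)} := hμ
    _ = μ {ω | HasInfiniteComponent (openGraph (F ω))} :=
      Measure.map_apply hF measurableSet_hasInfiniteComponent
    _ ≤ μ {ω | HasInfiniteComponent (openGraph ω)} := measure_mono h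

end InfiniteComponent

lemma percolates_of_isContained [Countable V] (h : G ⊑ H)
    (hG : ∀ μ ∈ DGe G p, Percolates μ) {μ : Measure (Config H)} (hμ : μ ∈ DGe H p) :
    Percolates μ := by
  obtain ⟨φ⟩ := h
  refine (hG _ (map_pull_mem_DGe φ.injective hμ)).of_map (isLocal_pull φ.injective).measurable
    fun ω hω ↦ hω.of_injective φ.injective fun u v huv ↦ ?_
  exact ((openHom φ.toHom ω).map_adj huv).reachable

section CriticalProbability

lemma DGe_anti (h : q ≤ p) : DGe G p ⊆ DGe G q :=
  fun _ ⟨hprob, hindep, hopen⟩ ↦ ⟨hprob, hindep, fun e ↦ h.trans (hopen e)⟩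

lemma pMax_nonneg (G : SimpleGraph V) : 0 ≤ pMax G :=
  Real.sSup_nonneg fun _ hp ↦ hp.1.1

lemma pMax_le (hp : 0 ≤ p) (h : ∀ μ ∈ DGe G p, Percolates μ) : pMax G ≤ p := by
  refine Real.sSup_le (fun q ⟨_, μ, hμ, hnot⟩ ↦ ?_) hp
  by_contra! hlt
  exact hnot (h μ (DGe_anti hlt.le hμ))

lemma pMax_anti [Countable V] (h : G ⊑ H) : pMax H ≤ pMax G := by
  refine Real.sSup_le (fun q ⟨hq, μ, hμ, hnot⟩ ↦ ?_) (pMax_nonneg G)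
  refine le_csSup ⟨1, fun _ hr ↦ hr.1.2⟩ ⟨hq, ?_⟩
  by_contra! hG
  exact hnot (percolates_of_isContained h hG hμ)

end CriticalProbability

section Fibers

variable {X Y : Type*} {K : SimpleGraph X} {Q : SimpleGraph Y} {μ : Measure (Config (K □ Q))}
  {P : ℝ}

/-- The open subgraph is connected with probability at least `P` in every model in
`𝒟_{≥p}(Q)`. -/
def ConnectedGe (Q : SimpleGraph Y) (p P : ℝ) : Prop :=
  ∀ μ ∈ DGe Q p, P ≤ μ.real {ω | (openGraph ω).Connected}

/-- The inclusion of the copy `{x} × Q` of `Q` into `K □ Q`. -/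
def fiberHom (K : SimpleGraph X) (Q : SimpleGraph Y) (x : X) : Q →g K □ Q :=
  (K.boxProdRight Q x).toHom

/-- The vertices `x` of `K` such that the open edges of `{x} × Q` connect all of `{x} × Q`. -/
def connectedFibers (ω : Config (K □ Q)) : Set X :=
  {x | (openGraph (pull (fiberHom K Q x) ω)).Connected}

/-- There is no open edge between the corresponding vertices of `{x} × Q` and `{y} × Q`. -/
def Separated (ω : Config (K □ Q)) (x y : X) : Prop :=
  ∀ c, ¬ (openGraph ω).Adj (x, c) (y, c)

lemma reachable_of_mem_connectedFibers {ω : Config (K □ Q)} {x : X}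
    (hx : x ∈ connectedFibers ω) (c c' : Y) : (openGraph ω).Reachable (x, c) (x, c') :=
  (hx.preconnected c c').map (openHom (fiberHom K Q x) ω)

lemma reachable_of_not_separated {ω : Config (K □ Q)} {x y : X} (hx : x ∈ connectedFibers ω)
    (hy : y ∈ connectedFibers ω) (hxy : ¬ Separated ω x y) (c c' : Y) :
    (openGraph ω).Reachable (x, c) (y, c') := by
  obtain ⟨d, hd⟩ := not_forall_not.mp hxy
  exact (reachable_of_mem_connectedFibers hx c d).trans
    (hd.reachable.trans (reachable_of_mem_connectedFibers hy d c'))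

lemma pairwise_disjoint_fst_fiber :
    Pairwise (Function.onFun Disjoint fun x : X ↦ (Prod.fst ⁻¹' {x} : Set (X × Y))) :=
  fun _ _ h ↦ (Set.disjoint_singleton.mpr h).preimage _

lemma measurableSet_mem_connectedFibers [Finite Y] (x : X) :
    MeasurableSet[edgeEvents (K □ Q) (Prod.fst ⁻¹' {x})] {ω | x ∈ connectedFibers ω} := by
  have hpull := measurable_pull_edgeEvents (fiberHom K Q x)
    (MeasurableSet.of_discrete (s := {ω | (openGraph ω).Connected}))
  exact edgeEvents_mono (by rintro _ ⟨c, rfl⟩; rfl) _ hpull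

lemma measurableSet_separated [Countable Y] (x y : X) :
    MeasurableSet[edgeEvents (K □ Q) (Prod.fst ⁻¹' {x, y})] {ω | Separated ω x y} := by
  simp only [Separated, Set.ofPred_forall]
  exact .iInter fun c ↦ (measurableSet_adj (by simp) (by simp)).compl

lemma le_measureReal_mem_connectedFibers [Finite Y] (hQ : ConnectedGe Q p P)
    (hμ : μ ∈ DGe (K □ Q) p) (x : X) : P ≤ μ.real {ω | x ∈ connectedFibers ω} := by
  have hinj : Function.Injective (fiberHom K Q x) := Prod.mk_right_injective x
  have hpull := hQ _ (map_pull_mem_DGe hinj hμ)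
  rwa [map_measureReal_apply (isLocal_pull hinj).measurable .of_discrete] at hpull

lemma setOf_subset_connectedFibers (T : Finset X) :
    {ω : Config (K □ Q) | ↑T ⊆ connectedFibers ω} = ⋂ x ∈ T, {ω | x ∈ connectedFibers ω} := by
  ext ω
  simp [Set.subset_def]

lemma measurableSet_subset_connectedFibers [Finite Y] (T : Finset X) :
    MeasurableSet[edgeEvents (K □ Q) (Prod.fst ⁻¹' T)] {ω | ↑T ⊆ connectedFibers ω} := by
  rw [setOf_subset_connectedFibers]
  exact Finset.measurableSet_biInter _ fun x hx ↦ edgeEvents_mono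
    (Set.preimage_mono (Set.singleton_subset_iff.mpr hx)) _ (measurableSet_mem_connectedFibers x)

lemma pow_card_le_measureReal_subset_connectedFibers [Finite Y] (hQ : ConnectedGe Q p P)
    (hP : 0 ≤ P) (hμ : μ ∈ DGe (K □ Q) p) (T : Finset X) :
    P ^ T.card ≤ μ.real {ω | ↑T ⊆ connectedFibers ω} := by
  have := hμ.1
  rw [setOf_subset_connectedFibers, hμ.2.1.measureReal_biInter pairwise_disjoint_fst_fiber T
    measurableSet_mem_connectedFibers, ← Finset.prod_const]
  exact Finset.prod_le_prod (fun _ _ ↦ hP) fun x _ ↦ le_measureReal_mem_connectedFibers hQ hμ x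

lemma measureReal_forall_not_subset_connectedFibers_le [Finite Y] (hQ : ConnectedGe Q p P)
    (hP : 0 ≤ P) (hμ : μ ∈ DGe (K □ Q) p) {ι : Type*} [Fintype ι] {T : ι → Finset X}
    (hT : Pairwise (Function.onFun Disjoint T)) {n : ℕ} (hcard : ∀ i, (T i).card = n) :
    μ.real {ω | ∀ i, ¬ ↑(T i) ⊆ connectedFibers ω} ≤ (1 - P ^ n) ^ Fintype.card ι := by
  have := hμ.1
  let R (i : ι) : Set (X × Y) := Prod.fst ⁻¹' T i
  have hR : Pairwise (Function.onFun Disjoint R) := fun i j hij ↦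
    (Finset.disjoint_coe.mpr (hT hij)).preimage _
  have hmeas (i : ι) : MeasurableSet[edgeEvents (K □ Q) (R i)] {ω | ↑(T i) ⊆ connectedFibers ω} :=
    measurableSet_subset_connectedFibers (T i)
  have hinter : {ω : Config (K □ Q) | ∀ i, ¬ ↑(T i) ⊆ connectedFibers ω} =
      ⋂ i ∈ Finset.univ, {ω | ↑(T i) ⊆ connectedFibers ω}ᶜ := by
    ext ω
    simp
  rw [hinter, hμ.2.1.measureReal_biInter hR _ fun i ↦ (hmeas i).compl, Fintype.card,
    ← Finset.prod_const]
  refine Finset.prod_le_prod (fun _ _ ↦ measureReal_nonneg) fun i _ ↦ ?_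
  rw [probReal_compl_eq_one_sub (edgeEvents_le _ _ (hmeas i)), ← hcard i]
  exact sub_le_sub_left (pow_card_le_measureReal_subset_connectedFibers hQ hP hμ (T i)) 1

lemma measureReal_separated_le [Finite Y] (hμ : μ ∈ DGe (K □ Q) p) {x y : X} (hxy : K.Adj x y) :
    μ.real {ω | Separated ω x y} ≤ (1 - p) ^ Nat.card Y := by
  have := hμ.1
  have := Fintype.ofFinite Y
  have hadj (c : Y) : (K □ Q).Adj (x, c) (y, c) := SimpleGraph.boxProd_adj_left.mpr hxy
  have hinter : {ω : Config (K □ Q) | Separated ω x y} =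
      ⋂ c ∈ Finset.univ, {ω | ω ⟨s((x, c), (y, c)), hadj c⟩ = false} := by
    ext ω
    simp [Separated, openGraph_adj_iff (hadj _)]
  have hlayer : Pairwise (Function.onFun Disjoint fun c : Y ↦ (Prod.snd ⁻¹' {c} : Set (X × Y))) :=
    fun _ _ h ↦ (Set.disjoint_singleton.mpr h).preimage _
  have hmeas (c : Y) : MeasurableSet[edgeEvents (K □ Q) (Prod.snd ⁻¹' {c})]
      {ω | ω ⟨s((x, c), (y, c)), hadj c⟩ = false} :=
    measurable_apply_edgeEvents (by simp +contextual [edgesWithin, or_imp])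
      (measurableSet_singleton false)
  rw [hinter, hμ.2.1.measureReal_biInter hlayer _ hmeas, Nat.card_eq_fintype_card, Fintype.card,
    ← Finset.prod_const]
  exact Finset.prod_le_prod (fun _ _ ↦ measureReal_nonneg) fun c _ ↦ measureReal_closed_le hμ _

lemma measurableSet_forall_mem_connectedFibers_iff [Countable X] [Finite Y] (S A : Set X) :
    MeasurableSet[edgeEvents (K □ Q) (Prod.fst ⁻¹' S)]
      {ω | ∀ z ∈ S, z ∈ connectedFibers ω ↔ z ∈ A} := by
  simp only [Set.ofPred_forall]
  refine .iInter fun z ↦ .iInter fun hz ↦ ?_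
  have hmem := edgeEvents_mono (Set.preimage_mono (Set.singleton_subset_iff.mpr hz)) _
    (measurableSet_mem_connectedFibers (K := K) (Q := Q) z)
  by_cases hzA : z ∈ A
  · simpa only [hzA, iff_true] using hmem
  · simp only [hzA, iff_false]
    exact hmem.compl

/-- Conditioning on which fibers are connected makes two adjacent connected fibers separated with
probability at most `(1 - p) ^ |Q| / P ^ 2`: the pattern away from the two fibers is independent
of everything that happens over them. -/
lemma measureReal_separated_inter_connectedFibers_eq_le [Finite X] [Finite Y]
    (hQ : ConnectedGe Q p P) (hP : 0 ≤ P) (hμ : μ ∈ DGe (K □ Q) p) {A : Set X} {x y : X}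
    (hx : x ∈ A) (hy : y ∈ A) (hxy : K.Adj x y) :
    P ^ 2 * μ.real {ω | Separated ω x y ∧ connectedFibers ω = A} ≤
      (1 - p) ^ Nat.card Y * μ.real {ω | connectedFibers ω = A} := by
  classical
  have := hμ.1
  let E : Set (Config (K □ Q)) :=
    {ω | ∀ z ∈ ({x, y}ᶜ : Set X), z ∈ connectedFibers ω ↔ z ∈ A}
  let C : Set (Config (K □ Q)) := {ω | {x, y} ⊆ connectedFibers ω}
  have hdisj : Disjoint (Prod.fst ⁻¹' {x, y} : Set (X × Y)) (Prod.fst ⁻¹' {x, y}ᶜ) :=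
    disjoint_compl_right.preimage _
  have hE : MeasurableSet[edgeEvents (K □ Q) (Prod.fst ⁻¹' {x, y}ᶜ)] E :=
    measurableSet_forall_mem_connectedFibers_iff _ A
  have hC : MeasurableSet[edgeEvents (K □ Q) (Prod.fst ⁻¹' {x, y})] C := by
    have hpair := measurableSet_subset_connectedFibers (K := K) (Q := Q) {x, y}
    rwa [Finset.coe_pair] at hpair
  have hpair : P ^ 2 ≤ μ.real C := by
    simpa only [Finset.card_pair hxy.ne, Finset.coe_pair] using
      pow_card_le_measureReal_subset_connectedFibers hQ hP hμ {x, y}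
  have hA : {ω : Config (K □ Q) | connectedFibers ω = A} = C ∩ E := by
    ext ω
    simp only [C, E, Set.ext_iff, Set.mem_inter_iff, Set.mem_ofPred_eq, Set.mem_compl_iff,
      Set.insert_subset_iff, Set.singleton_subset_iff, Set.mem_insert_iff, Set.mem_singleton_iff]
    grind
  have hsep : {ω : Config (K □ Q) | Separated ω x y ∧ connectedFibers ω = A} ⊆
      {ω | Separated ω x y} ∩ E := fun ω ⟨hω, hωA⟩ ↦ ⟨hω, fun z _ ↦ by rw [hωA]⟩
  have : 0 ≤ (1 - p) ^ Nat.card Y :=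
    measureReal_nonneg.trans (measureReal_separated_le hμ hxy)
  calc P ^ 2 * μ.real {ω | Separated ω x y ∧ connectedFibers ω = A}
      ≤ P ^ 2 * (μ.real {ω | Separated ω x y} * μ.real E) := by
        rw [← hμ.2.1.measureReal_inter hdisj (measurableSet_separated x y) hE]
        exact mul_le_mul_of_nonneg_left (measureReal_mono hsep) (sq_nonneg P)
    _ ≤ μ.real C * ((1 - p) ^ Nat.card Y * μ.real E) := by
        gcongr
        exact measureReal_separated_le hμ hxy
    _ = (1 - p) ^ Nat.card Y * μ.real {ω | connectedFibers ω = A} := by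
        rw [hA, hμ.2.1.measureReal_inter hdisj hC hE, mul_left_comm]

lemma measureReal_not_reachable_inter_connectedFibers_eq_le [Finite X] [Finite Y]
    (hQ : ConnectedGe Q p P) (hP : 0 ≤ P) (hμ : μ ∈ DGe (K □ Q) p) (c : Y) {A : Set X} {x y : X}
    (w : K.Walk x y) (hw : ∀ z ∈ w.support, z ∈ A) :
    P ^ 2 * μ.real {ω | ¬ (openGraph ω).Reachable (x, c) (y, c) ∧ connectedFibers ω = A} ≤
      w.length * ((1 - p) ^ Nat.card Y * μ.real {ω | connectedFibers ω = A}) := by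
  have := hμ.1
  induction w with
  | nil => simp
  | @cons x y z hxy w ih =>
    simp only [SimpleGraph.Walk.support_cons, List.forall_mem_cons] at hw
    have hy : y ∈ A := hw.2 y w.start_mem_support
    have hstep : {ω : Config (K □ Q) |
          ¬ (openGraph ω).Reachable (x, c) (z, c) ∧ connectedFibers ω = A} ⊆
        {ω | Separated ω x y ∧ connectedFibers ω = A} ∪
          {ω | ¬ (openGraph ω).Reachable (y, c) (z, c) ∧ connectedFibers ω = A} := by
      rintro ω ⟨hω, rfl⟩
      by_cases hsep : Separated ω x y
      · exact .inl ⟨hsep, rfl⟩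
      · exact .inr ⟨fun h ↦ hω ((reachable_of_not_separated hw.1 hy hsep c c).trans h), rfl⟩
    rw [SimpleGraph.Walk.length_cons, Nat.cast_add_one, add_one_mul, add_comm]
    refine (mul_le_mul_of_nonneg_left ((measureReal_mono hstep).trans (measureReal_union_le _ _))
      (sq_nonneg P)).trans ?_
    rw [mul_add]
    exact add_le_add (measureReal_separated_inter_connectedFibers_eq_le hQ hP hμ hw.1 hy hxy)
      (ih hw.2)

/-- The endpoints `s` and `t` and the walk between them may be selected with the knowledge of the
set of connected fibers, since the bound holds conditionally on that set. -/
lemma measureReal_exists_walk_not_reachable_le [Finite X] [Finite Y] (hQ : ConnectedGe Q p P)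
    (hP : 0 ≤ P) (hp : p ≤ 1) (hμ : μ ∈ DGe (K □ Q) p) (c : Y) (s t : Set X → X) (n : ℕ) :
    P ^ 2 * μ.real {ω | (∃ w : K.Walk (s (connectedFibers ω)) (t (connectedFibers ω)),
        w.length ≤ n ∧ ∀ z ∈ w.support, z ∈ connectedFibers ω) ∧
      ¬ (openGraph ω).Reachable (s (connectedFibers ω), c) (t (connectedFibers ω), c)} ≤
      n * (1 - p) ^ Nat.card Y := by
  classical
  have := hμ.1
  have := Fintype.ofFinite (Set X)
  set q := (1 - p) ^ Nat.card Y
  have : 0 ≤ q := pow_nonneg (sub_nonneg.mpr hp) _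
  let Good (A : Set X) : Prop := ∃ w : K.Walk (s A) (t A), w.length ≤ n ∧ ∀ z ∈ w.support, z ∈ A
  let B (A : Set X) : Set (Config (K □ Q)) :=
    {ω | ¬ (openGraph ω).Reachable (s A, c) (t A, c) ∧ connectedFibers ω = A}
  have hB (A : Set X) (hA : Good A) :
      P ^ 2 * μ.real (B A) ≤ n * (q * μ.real {ω | connectedFibers ω = A}) := by
    obtain ⟨w, hlen, hw⟩ := hA
    refine (measureReal_not_reachable_inter_connectedFibers_eq_le hQ hP hμ c w hw).trans ?_
    gcongr
  have htotal : ∑ A, μ.real {ω | connectedFibers ω = A} = 1 :=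
    (sum_measureReal_preimage_singleton Finset.univ fun _ _ ↦ .of_discrete).trans (by simp)
  calc _ ≤ P ^ 2 * μ.real (⋃ A ∈ Finset.univ.filter Good, B A) := by
        refine mul_le_mul_of_nonneg_left (measureReal_mono (fun ω ⟨hgood, hnot⟩ ↦ ?_)
          (measure_ne_top _ _)) (sq_nonneg P)
        exact Set.mem_biUnion (Finset.mem_filter.mpr ⟨Finset.mem_univ _, hgood⟩) ⟨hnot, rfl⟩
    _ ≤ P ^ 2 * ∑ A with Good A, μ.real (B A) :=
        mul_le_mul_of_nonneg_left (measureReal_biUnion_finset_le _ _) (sq_nonneg P)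
    _ ≤ ∑ A with Good A, n * (q * μ.real {ω | connectedFibers ω = A}) := by
        rw [Finset.mul_sum]
        exact Finset.sum_le_sum fun A hA ↦ hB A (Finset.mem_filter.mp hA).2
    _ ≤ ∑ A, n * (q * μ.real {ω | connectedFibers ω = A}) :=
        Finset.sum_le_univ_sum_of_nonneg fun A ↦ by positivity
    _ = n * q := by
        rw [← Finset.mul_sum, ← Finset.mul_sum, htotal, mul_one]

end Fibers

section Doubling

variable {X Y : Type*} {Q : SimpleGraph X} {Q' : SimpleGraph Y} {P : ℝ}

lemma ConnectedGe.of_bijective [Finite Y] (hQ : ConnectedGe Q p P) {φ : Q →g Q'}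
    (hφ : Function.Bijective φ) : ConnectedGe Q' p P := by
  intro μ hμ
  have := hμ.1
  have hpull := hQ _ (map_pull_mem_DGe hφ.injective hμ)
  have := Finite.of_injective φ hφ.injective
  rw [map_measureReal_apply (isLocal_pull hφ.injective).measurable .of_discrete] at hpull
  exact hpull.trans (measureReal_mono fun ω hω ↦ hω.map (openHom φ ω) hφ.surjective)

lemma ConnectedGe.boxProd_bool [Finite X] (hQ : ConnectedGe Q p P) (hP : 0 ≤ P) :
    ConnectedGe ((⊤ : SimpleGraph Bool) □ Q) p (P ^ 2 - (1 - p) ^ Nat.card X) := by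
  intro μ hμ
  have := hμ.1
  have hboth : P ^ 2 ≤ μ.real {ω | ↑(Finset.univ : Finset Bool) ⊆ connectedFibers ω} :=
    pow_card_le_measureReal_subset_connectedFibers hQ hP hμ Finset.univ
  have hsep : μ.real {ω | Separated ω false true} ≤ (1 - p) ^ Nat.card X :=
    measureReal_separated_le hμ (by simp)
  have hsub : {ω : Config ((⊤ : SimpleGraph Bool) □ Q) |
      ↑(Finset.univ : Finset Bool) ⊆ connectedFibers ω} ⊆
      {ω | (openGraph ω).Connected} ∪ {ω | Separated ω false true} := by
    intro ω hω
    refine or_iff_not_imp_right.mpr fun hnot ↦ ?_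
    have hmem (b : Bool) : b ∈ connectedFibers ω := hω (by simp)
    obtain ⟨c⟩ := (hmem false).nonempty
    refine (SimpleGraph.connected_iff_exists_forall_reachable _).mpr ⟨(false, c), ?_⟩
    rintro ⟨_ | _, c'⟩
    · exact reachable_of_mem_connectedFibers (hmem false) c c'
    · exact reachable_of_not_separated (hmem false) (hmem true) hnot c c'
  linarith [(measureReal_mono hsub).trans (measureReal_union_le (μ := μ) _ _)]

/-- The two facets `x₀ = 0` and `x₀ = 1` of the cube are copies of the cube of one dimension less,
with corresponding vertices adjacent. -/
def boolBoxProdCube (k : ℕ) : ((⊤ : SimpleGraph Bool) □ cube k) →g cube (k + 1) where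
  toFun x := Fin.cons x.1 x.2
  map_rel' {x y} h := by
    obtain ⟨hne, heq⟩ | ⟨⟨i, hi, huniq⟩, heq⟩ := h
    · refine ⟨0, hne, fun j hj ↦ ?_⟩
      cases j using Fin.cases with
      | zero => rfl
      | succ j => exact absurd (congrFun heq j) (by simpa using hj)
    · refine ⟨i.succ, by simpa using hi, fun j hj ↦ ?_⟩
      cases j using Fin.cases with
      | zero => exact absurd heq (by simpa using hj)
      | succ j => exact congrArg Fin.succ (huniq j (by simpa using hj))

lemma bijective_boolBoxProdCube (k : ℕ) : Function.Bijective (boolBoxProdCube k) :=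
  (Fin.consEquiv fun _ ↦ Bool).bijective

lemma ConnectedGe.cube_succ {k : ℕ} (hQ : ConnectedGe (cube k) p P) (hP : 0 ≤ P) :
    ConnectedGe (cube (k + 1)) p (P ^ 2 - (1 - p) ^ 2 ^ k) := by
  simpa using (hQ.boxProd_bool hP).of_bijective (bijective_boolBoxProdCube k)

open scoped goldenRatio

/-- Since `φ² = φ + 1`, each doubling of the cube also doubles the excess `d` of the ratio between
the connection probability and `(1 - p) ^ 2 ^ (k - 1)` over the golden ratio. -/
lemma ConnectedGe.exists_cube_add {m : ℕ} (hp : p ≤ 1) {d : ℝ} (hd : 0 ≤ d)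
    (hP : (φ + d) * (1 - p) ^ 2 ^ m < P) (hQ : ConnectedGe (cube (m + 1)) p P) (j : ℕ) :
    ∃ P', (φ + 2 ^ j * d) * (1 - p) ^ 2 ^ (m + j) < P' ∧
      ConnectedGe (cube (m + j + 1)) p P' := by
  induction j with
  | zero => exact ⟨P, by simpa using hP, hQ⟩
  | succ j ih =>
    obtain ⟨P', hP', hQ'⟩ := ih
    set s := (1 - p) ^ 2 ^ (m + j)
    set D := 2 ^ j * d
    have : 0 ≤ s := pow_nonneg (sub_nonneg.mpr hp) _
    have hsq : (1 - p) ^ 2 ^ (m + (j + 1)) = s ^ 2 := by rw [← pow_mul, ← pow_succ, add_assoc]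
    have hD : 0 ≤ D := by positivity
    have hφ : 1 < φ := Real.one_lt_goldenRatio
    have hP'₀ : 0 ≤ (φ + D) * s := by positivity
    refine ⟨P' ^ 2 - (1 - p) ^ 2 ^ (m + j + 1), ?_, hQ'.cube_succ (hP'₀.trans hP'.le)⟩
    have hratio : φ + 2 * D + 1 ≤ (φ + D) ^ 2 := by nlinarith [Real.goldenRatio_sq]
    rw [add_assoc m j 1, hsq, pow_succ', mul_assoc]
    calc (φ + 2 * D) * s ^ 2 = (φ + 2 * D + 1) * s ^ 2 - s ^ 2 := by ring
      _ ≤ ((φ + D) * s) ^ 2 - s ^ 2 := by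
        rw [mul_pow]
        gcongr
      _ < P' ^ 2 - s ^ 2 := by gcongr

lemma ConnectedGe.exists_cube_mul_le {k : ℕ} (hk : 1 ≤ k) (hp : p ≤ 1)
    (hP : (1 - p) ^ 2 ^ (k - 1) * φ < P) (hQ : ConnectedGe (cube k) p P) (C : ℝ) :
    ∃ k' P', 0 < P' ∧ C * (1 - p) ^ 2 ^ k' ≤ P' ^ 2 ∧ ConnectedGe (cube k') p P' := by
  obtain ⟨m, rfl⟩ := Nat.exists_eq_add_of_le' hk
  rw [Nat.add_sub_cancel, mul_comm] at hP
  have hs (i : ℕ) : 0 ≤ (1 - p) ^ 2 ^ i := pow_nonneg (sub_nonneg.mpr hp) _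
  obtain ⟨d, hd, hdP⟩ : ∃ d > 0, (φ + d) * (1 - p) ^ 2 ^ m < P := by
    have hcont : Tendsto (fun d ↦ (φ + d) * (1 - p) ^ 2 ^ m) (𝓝[>] 0)
        (𝓝 (φ * (1 - p) ^ 2 ^ m)) := by
      refine tendsto_nhdsWithin_of_tendsto_nhds (Continuous.tendsto' (by fun_prop) _ _ (by simp))
    exact ((eventually_mem_nhdsWithin).and (hcont.eventually_lt_const hP)).exists
  obtain ⟨j, hj⟩ : ∃ j : ℕ, max 1 C / d < 2 ^ j := pow_unbounded_of_one_lt _ one_lt_two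
  obtain ⟨P', hP', hQ'⟩ := hQ.exists_cube_add hp hd.le hdP j
  have hlarge : max 1 C ≤ φ + 2 ^ j * d := by
    rw [div_lt_iff₀ hd] at hj
    linarith [Real.goldenRatio_pos]
  refine ⟨m + j + 1, P', ?_, ?_, hQ'⟩
  · exact (mul_nonneg (zero_le_one.trans ((le_max_left 1 C).trans hlarge)) (hs _)).trans_lt hP'
  · calc C * (1 - p) ^ 2 ^ (m + j + 1) ≤ (φ + 2 ^ j * d) ^ 2 * ((1 - p) ^ 2 ^ (m + j)) ^ 2 := by
          rw [← pow_mul, ← pow_succ]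
          gcongr
          nlinarith [(le_max_left 1 C).trans hlarge, (le_max_right 1 C).trans hlarge]
      _ ≤ P' ^ 2 := by
          rw [← mul_pow]
          have := hs (m + j)
          gcongr

end Doubling

section DisjointClosedEdges

/-- Two edges within `R` that have no common vertex are closed. -/
def HasDisjointClosed (ω : Config G) (R : Set V) : Prop :=
  ∃ e ∈ edgesWithin G R, ∃ f ∈ edgesWithin G R,
    VertexDisjoint {e} {f} ∧ ω e = false ∧ ω f = false

lemma measurableSet_closed {R : Set V} {e : G.edgeSet} (he : e ∈ edgesWithin G R) :
    MeasurableSet[edgeEvents G R] {ω | ω e = false} :=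
  measurable_apply_edgeEvents he (measurableSet_singleton false)

lemma setOf_hasDisjointClosed (R : Set V) : {ω : Config G | HasDisjointClosed ω R} =
    ⋃ e ∈ edgesWithin G R, ⋃ f ∈ edgesWithin G R,
      {ω | VertexDisjoint {e} {f} ∧ ω e = false ∧ ω f = false} := by
  ext ω
  simp only [HasDisjointClosed, Set.mem_iUnion, Set.mem_ofPred_eq, exists_prop]

lemma measurableSet_hasDisjointClosed [Countable V] (R : Set V) :
    MeasurableSet[edgeEvents G R] {ω | HasDisjointClosed ω R} := by
  have hcount : (edgesWithin G R).Countable :=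
    Set.to_countable (edgesWithin G R)
  rw [setOf_hasDisjointClosed]
  refine .biUnion hcount fun e he ↦ .biUnion hcount fun f hf ↦ ?_
  exact (MeasurableSet.const _).inter ((measurableSet_closed he).inter (measurableSet_closed hf))

lemma exists_finset_coe_eq_edgesWithin (s : Finset V) :
    ∃ T : Finset G.edgeSet, (T : Set G.edgeSet) = edgesWithin G (s : Set V) ∧
      T.card ≤ (s.card + 1).choose 2 := by
  classical
  refine ⟨s.sym2.subtype (· ∈ G.edgeSet), ?_, ?_⟩
  · ext e
    simp only [Finset.mem_coe, Finset.mem_subtype, Finset.mem_sym2_iff]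
    rfl
  · rw [Finset.card_subtype, ← Finset.card_sym2]
    exact Finset.card_filter_le _ _

lemma measureReal_vertexDisjoint_closed_le (hμ : μ ∈ DGe G p) (e f : G.edgeSet) :
    μ.real {ω | VertexDisjoint {e} {f} ∧ ω e = false ∧ ω f = false} ≤ (1 - p) ^ 2 := by
  by_cases hef : VertexDisjoint {e} {f}
  · have hdisj : Disjoint (e : Set V) (f : Set V) :=
      Set.disjoint_left.mpr (hef e rfl f rfl)
    have heq : {ω : Config G | VertexDisjoint {e} {f} ∧ ω e = false ∧ ω f = false} =
        {ω | ω e = false} ∩ {ω | ω f = false} := by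
      simp only [hef, true_and, Set.ofPred_and]
    have hclosed := measureReal_closed_le hμ
    rw [heq, hμ.2.1.measureReal_inter hdisj (measurableSet_closed fun _ ↦ id)
      (measurableSet_closed fun _ ↦ id), sq]
    exact mul_le_mul (hclosed e) (hclosed f) measureReal_nonneg
      (measureReal_nonneg.trans (hclosed e))
  · simpa [hef] using sq_nonneg _

lemma measureReal_hasDisjointClosed_le (hμ : μ ∈ DGe G p) (s : Finset V) :
    μ.real {ω | HasDisjointClosed ω (s : Set V)} ≤ ((s.card + 1).choose 2 * (1 - p)) ^ 2 := by
  have := hμ.1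
  obtain ⟨T, hT, hcard⟩ := exists_finset_coe_eq_edgesWithin (G := G) s
  have hsum : μ.real {ω | HasDisjointClosed ω (s : Set V)} ≤
      ∑ e ∈ T, ∑ f ∈ T, μ.real {ω | VertexDisjoint {e} {f} ∧ ω e = false ∧ ω f = false} := by
    rw [setOf_hasDisjointClosed, ← hT]
    exact (measureReal_biUnion_finset_le _ _).trans
      (Finset.sum_le_sum fun e _ ↦ measureReal_biUnion_finset_le _ _)
  calc μ.real {ω | HasDisjointClosed ω (s : Set V)}
      ≤ ∑ e ∈ T, ∑ f ∈ T, (1 - p) ^ 2 := hsum.trans <| Finset.sum_le_sum fun e _ ↦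
        Finset.sum_le_sum fun f _ ↦ measureReal_vertexDisjoint_closed_le hμ e f
    _ = T.card ^ 2 * (1 - p) ^ 2 := by
      simp only [Finset.sum_const, nsmul_eq_mul]
      ring
    _ ≤ ((s.card + 1).choose 2 * (1 - p)) ^ 2 := by
      rw [mul_pow]
      gcongr

end DisjointClosedEdges

section Plane

lemma exists_forall_mem_of_cliqueFree_three [Nonempty V] (hG : G.CliqueFree 3)
    {S : Set G.edgeSet} (hS : ∀ e ∈ S, ∀ f ∈ S, ¬ VertexDisjoint {e} {f}) :
    ∃ w, ∀ e ∈ S, w ∈ (e : Sym2 V) := by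
  have hmeet {e f : G.edgeSet} (he : e ∈ S) (hf : f ∈ S) :
      ∃ v, v ∈ (e : Sym2 V) ∧ v ∈ (f : Sym2 V) := by
    by_contra! hef
    exact hS e he f hf (by rintro _ rfl _ rfl; exact hef)
  obtain rfl | ⟨⟨e, he⟩, heS⟩ := S.eq_empty_or_nonempty
  · simp
  induction e with | h a b
  by_contra! hnot
  obtain ⟨⟨f, hf⟩, hfS, haf⟩ := hnot a
  obtain ⟨⟨g, hg⟩, hgS, hbg⟩ := hnot b
  have hbf : b ∈ f := by
    obtain ⟨v, hv, hvf⟩ := hmeet heS hfS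
    obtain rfl | rfl := Sym2.mem_iff.mp hv
    exacts [absurd hvf haf, hvf]
  have hag : a ∈ g := by
    obtain ⟨v, hv, hvg⟩ := hmeet heS hgS
    obtain rfl | rfl := Sym2.mem_iff.mp hv
    exacts [hvg, absurd hvg hbg]
  obtain ⟨c, hcf, hcg⟩ := hmeet hfS hgS
  have hbc : b ≠ c := fun h ↦ hbg (h ▸ hcg)
  have hac : a ≠ c := fun h ↦ haf (h ▸ hcf)
  rw [(Sym2.mem_and_mem_iff hbc).mp ⟨hbf, hcf⟩] at hf
  rw [(Sym2.mem_and_mem_iff hac).mp ⟨hag, hcg⟩] at hg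
  classical
  exact hG {a, b, c} (SimpleGraph.is3Clique_triple_iff.mpr ⟨he, hg, hf⟩)

/-- The square lattice. -/
noncomputable abbrev plane : SimpleGraph (ℤ × ℤ) := SimpleGraph.hasse ℤ □ SimpleGraph.hasse ℤ

lemma plane_adj_iff {a b : ℤ × ℤ} : plane.Adj a b ↔
    (a.1 + 1 = b.1 ∨ b.1 + 1 = a.1) ∧ a.2 = b.2 ∨ (a.2 + 1 = b.2 ∨ b.2 + 1 = a.2) ∧ a.1 = b.1 := by
  simp only [SimpleGraph.boxProd_adj, SimpleGraph.hasse_adj, Order.covBy_iff_add_one_eq]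

lemma plane_cliqueFree_three : plane.CliqueFree 3 := by
  let parity : plane.Coloring Bool := SimpleGraph.Coloring.mk (fun a ↦ decide (Even (a.1 + a.2)))
    fun {a b} h ↦ by
      rw [plane_adj_iff] at h
      simp only [ne_eq, decide_eq_decide, Int.even_iff]
      omega
  exact parity.colorable.cliqueFree (by simp)

lemma reachable_of_ordConnected {I : Set ℤ} (hI : I.OrdConnected) {f : ℤ → V}
    (h : ∀ x ∈ I, x + 1 ∈ I → G.Adj (f x) (f (x + 1))) {x y : ℤ} (hx : x ∈ I) (hy : y ∈ I) :
    G.Reachable (f x) (f y) := by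
  wlog hxy : x ≤ y generalizing x y
  · exact (this hy hx (le_of_not_ge hxy)).symm
  induction y, hxy using Int.leInduction with
  | base => exact .refl _
  | succ y hxy ih =>
    have hyI : y ∈ I := hI.out hx hy ⟨hxy, by omega⟩
    exact (ih hyI).trans (h y hyI hy).reachable

lemma reachable_of_mem_prod_of_ne {I J : Set ℤ} (hI : I.OrdConnected) (hJ : J.OrdConnected)
    (hI' : I.Nontrivial) (hJ' : J.Nontrivial) {H : SimpleGraph (ℤ × ℤ)} {w : ℤ × ℤ}
    (h : ∀ a ∈ I ×ˢ J, ∀ b ∈ I ×ˢ J, a ≠ w → b ≠ w → plane.Adj a b → H.Adj a b)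
    {a b : ℤ × ℤ} (ha : a ∈ I ×ˢ J) (hb : b ∈ I ×ˢ J) (haw : a ≠ w) (hbw : b ≠ w) :
    H.Reachable a b := by
  have row {y x x' : ℤ} (hyw : y ≠ w.2) (hy : y ∈ J) (hx : x ∈ I) (hx' : x' ∈ I) :
      H.Reachable (x, y) (x', y) :=
    reachable_of_ordConnected hI (f := fun x ↦ (x, y)) (fun x hx hx' ↦ h _ ⟨hx, hy⟩ _ ⟨hx', hy⟩
      (fun h ↦ hyw (congrArg Prod.snd h)) (fun h ↦ hyw (congrArg Prod.snd h))
      (plane_adj_iff.mpr (.inl ⟨.inl rfl, rfl⟩))) hx hx'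
  have column {x y y' : ℤ} (hxw : x ≠ w.1) (hx : x ∈ I) (hy : y ∈ J) (hy' : y' ∈ J) :
      H.Reachable (x, y) (x, y') :=
    reachable_of_ordConnected hJ (f := fun y ↦ (x, y)) (fun y hy hy' ↦ h _ ⟨hx, hy⟩ _ ⟨hx, hy'⟩
      (fun h ↦ hxw (congrArg Prod.fst h)) (fun h ↦ hxw (congrArg Prod.fst h))
      (plane_adj_iff.mpr (.inr ⟨.inl rfl, rfl⟩))) hy hy'
  obtain ⟨x₀, hx₀, hxw₀⟩ := hI'.exists_ne w.1
  obtain ⟨y₀, hy₀, hyw₀⟩ := hJ'.exists_ne w.2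
  have hbase {a : ℤ × ℤ} (ha : a ∈ I ×ˢ J) (haw : a ≠ w) : H.Reachable a (x₀, y₀) := by
    by_cases hy : a.2 = w.2
    · have hx : a.1 ≠ w.1 := fun hx ↦ haw (Prod.ext hx hy)
      exact (column hx ha.1 ha.2 hy₀).trans (row hyw₀ hy₀ ha.1 hx₀)
    · exact (row hy ha.2 ha.1 hx₀).trans (column hxw₀ hx₀ ha.2 hy₀)
  exact (hbase ha haw).trans (hbase hb hbw).symm

end Plane

section Renormalization

/-- The index of the `2 × 2` block that contains a point of the plane. -/
def half (a : ℤ × ℤ) : ℤ × ℤ := (a.1 / 2, a.2 / 2)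

open Classical in
/-- The renormalized configuration: an edge between two blocks is open if no two edges without
common vertex inside the union of the two blocks are closed. -/
noncomputable def renorm (ω : Config plane) : Config plane :=
  fun e ↦ decide ¬ HasDisjointClosed ω {x | half x ∈ (e : Sym2 (ℤ × ℤ))}

lemma isLocal_renorm : IsLocal renorm fun b ↦ {x | half x = b} where
  disjoint _ _ hab := Set.disjoint_left.mpr fun _ ha hb ↦ hab (ha.symm.trans hb)
  measurable_apply e := by
    have hregion : ⋃ b ∈ (e : Sym2 (ℤ × ℤ)), {x | half x = b} = {x | half x ∈ (e : Sym2 _)} := by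
      ext
      simp
    rw [hregion]
    refine measurable_to_bool (MeasurableSet.congr (measurableSet_hasDisjointClosed _).compl ?_)
    ext ω
    simp [renorm]

/-- The rectangle spanned by the blocks `a` and `b`. -/
noncomputable def blockRect (a b : ℤ × ℤ) : Finset (ℤ × ℤ) :=
  Finset.Icc (2 * min a.1 b.1) (2 * max a.1 b.1 + 1) ×ˢ
    Finset.Icc (2 * min a.2 b.2) (2 * max a.2 b.2 + 1)

lemma coe_blockRect {a b : ℤ × ℤ} (h : plane.Adj a b) :
    (blockRect a b : Set (ℤ × ℤ)) = {x | half x ∈ s(a, b)} := by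
  rw [plane_adj_iff] at h
  ext x
  simp only [blockRect, half, Finset.coe_product, Finset.coe_Icc, Set.mem_prod, Set.mem_Icc,
    Set.mem_ofPred_eq, Sym2.mem_iff, Prod.ext_iff]
  omega

lemma card_blockRect {a b : ℤ × ℤ} (h : plane.Adj a b) : (blockRect a b).card = 8 := by
  rw [plane_adj_iff] at h
  rw [blockRect, Finset.card_product, Int.card_Icc, Int.card_Icc]
  obtain ⟨h₁, h₂⟩ | ⟨h₁, h₂⟩ := h
  · have hx : (2 * max a.1 b.1 + 1 + 1 - 2 * min a.1 b.1).toNat = 4 := by omega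
    have hy : (2 * max a.2 b.2 + 1 + 1 - 2 * min a.2 b.2).toNat = 2 := by omega
    rw [hx, hy]
  · have hx : (2 * max a.1 b.1 + 1 + 1 - 2 * min a.1 b.1).toNat = 2 := by omega
    have hy : (2 * max a.2 b.2 + 1 + 1 - 2 * min a.2 b.2).toNat = 4 := by omega
    rw [hx, hy]

lemma map_renorm_mem_DGe {ε : ℝ} (hε₀ : 0 ≤ ε) (hε : ε ≤ 1 / 2592) {μ : Measure (Config plane)}
    (hμ : μ ∈ DGe plane (1 - ε)) : μ.map renorm ∈ DGe plane (1 - ε / 2) := by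
  have := hμ.1
  refine isLocal_renorm.map_mem_DGe hμ fun ⟨e, he⟩ ↦ ?_
  induction e with | h a b
  have hmeas : MeasurableSet {ω : Config plane | HasDisjointClosed ω {x | half x ∈ s(a, b)}} :=
    edgeEvents_le _ _ (measurableSet_hasDisjointClosed _)
  have hbad := measureReal_hasDisjointClosed_le hμ (blockRect a b)
  rw [card_blockRect he, coe_blockRect he, show (8 + 1 : ℕ).choose 2 = 36 from rfl, sub_sub_cancel,
    Nat.cast_ofNat] at hbad
  have hcompl : {ω : Config plane | renorm ω ⟨s(a, b), he⟩ = true} =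
      {ω | HasDisjointClosed ω {x | half x ∈ s(a, b)}}ᶜ := by
    ext ω
    simp [renorm]
  rw [hcompl, probReal_compl_eq_one_sub hmeas]
  -- Since `2592 = 2 * 36 ^ 2`, the bound `(36 * ε) ^ 2` is at most `ε / 2`.
  nlinarith

lemma map_renorm_iterate_mem_DGe {ε : ℝ} (hε₀ : 0 ≤ ε) (hε : ε ≤ 1 / 2592)
    {μ : Measure (Config plane)} (hμ : μ ∈ DGe plane (1 - ε)) (j : ℕ) :
    μ.map renorm^[j] ∈ DGe plane (1 - ε / 2 ^ j) := by
  have := hμ.1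
  induction j with
  | zero => simpa using hμ
  | succ j ih =>
    have hj : ε / 2 ^ j ≤ 1 / 2592 := (div_le_self hε₀ (one_le_pow₀ one_le_two)).trans hε
    have hmap : μ.map renorm^[j + 1] = (μ.map renorm^[j]).map renorm := by
      rw [Measure.map_map isLocal_renorm.measurable (isLocal_renorm.measurable.iterate j),
        Function.iterate_succ']
    rw [hmap, pow_succ, ← div_div]
    exact map_renorm_mem_DGe (by positivity) hj ih

variable {ω : Config plane}

lemma exists_reachable_of_adj_renorm {a b : ℤ × ℤ} (h : (openGraph (renorm ω)).Adj a b) :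
    ∃ w, ∀ x y, half x ∈ s(a, b) → half y ∈ s(a, b) → x ≠ w → y ≠ w →
      (openGraph ω).Reachable x y := by
  obtain ⟨hab, hopen⟩ := h
  have hnot : ¬ HasDisjointClosed ω {x | half x ∈ s(a, b)} := by simpa [renorm] using hopen
  obtain ⟨w, hw⟩ := exists_forall_mem_of_cliqueFree_three plane_cliqueFree_three
    (S := {e | e ∈ edgesWithin plane {x | half x ∈ s(a, b)} ∧ ω e = false})
    fun e he f hf hef ↦ hnot ⟨e, he.1, f, hf.1, hef, he.2, hf.2⟩
  have hrect : {x | half x ∈ s(a, b)} = Set.Icc (2 * min a.1 b.1) (2 * max a.1 b.1 + 1) ×ˢ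
      Set.Icc (2 * min a.2 b.2) (2 * max a.2 b.2 + 1) := by
    rw [← coe_blockRect hab, blockRect, Finset.coe_product, Finset.coe_Icc, Finset.coe_Icc]
  have hI (m n : ℤ) : (Set.Icc (2 * min m n) (2 * max m n + 1)).Nontrivial :=
    ⟨_, Set.left_mem_Icc.mpr (by omega), _, Set.right_mem_Icc.mpr (by omega), by omega⟩
  refine ⟨w, fun x y hx hy ↦ reachable_of_mem_prod_of_ne Set.ordConnected_Icc
    Set.ordConnected_Icc (hI a.1 b.1) (hI a.2 b.2) (fun x hx y hy hxw hyw hxy ↦ ?_)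
    (hrect ▸ hx) (hrect ▸ hy)⟩
  rw [← hrect] at hx hy
  rw [openGraph_adj_iff hxy, ← Bool.not_eq_false]
  intro hclosed
  have hinner : ⟨s(x, y), hxy⟩ ∈ edgesWithin plane {x | half x ∈ s(a, b)} :=
    Sym2.ball.mpr ⟨hx, hy⟩
  obtain rfl | rfl := Sym2.mem_iff.mp (hw _ ⟨hinner, hclosed⟩)
  exacts [hxw rfl, hyw rfl]

/-- The point `v` of the block `b` is connected to all other points of the block, with at most one
exception. -/
def IsMajority (ω : Config plane) (b v : ℤ × ℤ) : Prop :=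
  half v = b ∧ ∃ w, ∀ x, half x = b → x ≠ w → (openGraph ω).Reachable v x

lemma exists_half_eq_ne_ne (b w w' : ℤ × ℤ) : ∃ x, half x = b ∧ x ≠ w ∧ x ≠ w' := by
  by_contra! h
  have h₁ := h (2 * b.1, 2 * b.2)
  have h₂ := h (2 * b.1 + 1, 2 * b.2)
  have h₃ := h (2 * b.1, 2 * b.2 + 1)
  simp only [half, ne_eq, Prod.ext_iff] at h₁ h₂ h₃
  omega

lemma IsMajority.reachable {a b u v : ℤ × ℤ} (hu : IsMajority ω a u) (hv : IsMajority ω b v)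
    (h : (openGraph (renorm ω)).Adj a b) : (openGraph ω).Reachable u v := by
  obtain ⟨w, hw⟩ := exists_reachable_of_adj_renorm h
  obtain ⟨-, wu, hwu⟩ := hu
  obtain ⟨-, wv, hwv⟩ := hv
  obtain ⟨x, hxa, hxw, hxu⟩ := exists_half_eq_ne_ne a w wu
  obtain ⟨y, hyb, hyw, hyv⟩ := exists_half_eq_ne_ne b w wv
  exact ((hwu x hxa hxu).trans (hw x y (by simp [hxa]) (by simp [hyb]) hxw hyw)).trans
    (hwv y hyb hyv).symm

lemma exists_isMajority {a b : ℤ × ℤ} (h : (openGraph (renorm ω)).Adj a b) :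
    ∃ v, IsMajority ω a v := by
  obtain ⟨w, hw⟩ := exists_reachable_of_adj_renorm h
  obtain ⟨v, hva, hvw, -⟩ := exists_half_eq_ne_ne a w w
  exact ⟨v, hva, w, fun x hxa hxw ↦ hw v x (by simp [hva]) (by simp [hxa]) hvw hxw⟩

lemma exists_section_half (ω : Config plane) : ∃ r : ℤ × ℤ → ℤ × ℤ, (∀ b, half (r b) = b) ∧
    ∀ a b, (openGraph (renorm ω)).Adj a b → (openGraph ω).Reachable (r a) (r b) := by
  have hpoint (b : ℤ × ℤ) : ∃ v, half v = b ∧ ((∃ v, IsMajority ω b v) → IsMajority ω b v) := by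
    by_cases h : ∃ v, IsMajority ω b v
    · exact h.imp fun v hv ↦ ⟨hv.1, fun _ ↦ hv⟩
    · obtain ⟨v, hv, -⟩ := exists_half_eq_ne_ne b b b
      exact ⟨v, hv, fun h' ↦ absurd h' h⟩
  choose r hr hmaj using hpoint
  exact ⟨r, hr, fun a b hab ↦ (hmaj a (exists_isMajority hab)).reachable
    (hmaj b (exists_isMajority hab.symm)) hab⟩

/-- The edges from the origin to `(1, 0)` and to `(0, 1)`, and the edge from `(1, 0)` to `(1, 1)`,
are open: three edges connecting the block of the origin. -/
def OriginOpen (ω : Config plane) : Prop :=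
  (openGraph ω).Adj (0, 0) (1, 0) ∧ (openGraph ω).Adj (0, 0) (0, 1) ∧
    (openGraph ω).Adj (1, 0) (1, 1)

lemma OriginOpen.reachable (h : OriginOpen ω) {x : ℤ × ℤ} (hx : half x = (0, 0)) :
    (openGraph ω).Reachable (0, 0) x := by
  obtain ⟨h₁, h₂, h₃⟩ := h
  obtain ⟨x₁, x₂⟩ := x
  simp only [half, Prod.mk.injEq] at hx
  obtain rfl | rfl : x₁ = 0 ∨ x₁ = 1 := by omega
  all_goals obtain rfl | rfl : x₂ = 0 ∨ x₂ = 1 := by omega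
  exacts [.refl _, h₂.reachable, h₁.reachable, h₁.reachable.trans h₃.reachable]

lemma exists_section_iterate_half (h : ∀ j, OriginOpen (renorm^[j] ω)) (j : ℕ) :
    ∃ r : ℤ × ℤ → ℤ × ℤ, (∀ b, half^[j] (r b) = b) ∧
      (∀ a b, (openGraph (renorm^[j] ω)).Adj a b → (openGraph ω).Reachable (r a) (r b)) ∧
      (openGraph ω).Reachable (0, 0) (r (0, 0)) := by
  induction j with
  | zero => exact ⟨id, fun _ ↦ rfl, fun _ _ ↦ SimpleGraph.Adj.reachable, .refl _⟩
  | succ j ih =>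
    obtain ⟨r, hr, hadj, horigin⟩ := ih
    obtain ⟨s, hs, hs_adj⟩ := exists_section_half (renorm^[j] ω)
    refine ⟨r ∘ s, fun b ↦ ?_, fun a b hab ↦ reachable_map_of_forall_adj hadj (hs_adj a b ?_), ?_⟩
    · rw [Function.iterate_succ_apply', Function.comp_apply, hr, hs]
    · rwa [Function.iterate_succ_apply'] at hab
    · exact horigin.trans (reachable_map_of_forall_adj hadj ((h j).reachable (hs _)))

lemma eq_of_iterate_half_eq {x : ℤ × ℤ} {i j : ℕ} (hi : half^[i] x = (1, 0))
    (hj : half^[j] x = (1, 0)) : i = j := by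
  wlog hij : i < j generalizing i j
  · by_contra hne
    exact hne (this hj hi (by omega)).symm
  obtain ⟨m, rfl⟩ := Nat.exists_eq_add_of_lt hij
  have hzero (n : ℕ) : half^[n] (0, 0) = (0, 0) := Function.iterate_fixed rfl n
  rw [show i + m + 1 = m + 1 + i by omega, Function.iterate_add_apply, hi,
    Function.iterate_succ_apply, show half (1, 0) = (0, 0) from rfl, hzero] at hj
  simp at hj

lemma hasInfiniteComponent_of_originOpen (h : ∀ j, OriginOpen (renorm^[j] ω)) :
    HasInfiniteComponent (openGraph ω) := by
  choose r hr hadj horigin using exists_section_iterate_half h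
  have hinj : Function.Injective fun j ↦ r j (1, 0) := by
    intro i j (hij : r i (1, 0) = r j (1, 0))
    exact eq_of_iterate_half_eq (hr i (1, 0)) (hij ▸ hr j (1, 0))
  exact hasInfiniteComponent_iff.mpr ⟨(0, 0), Set.infinite_of_injective_forall_mem hinj
    fun j ↦ (horigin j).trans (hadj j _ _ (h j).1)⟩

lemma measureReal_not_adj_le (hμ : μ ∈ DGe G p) {u v : V} (h : G.Adj u v) :
    μ.real {ω | ¬ (openGraph ω).Adj u v} ≤ 1 - p := by
  simpa only [openGraph_adj_iff h, Bool.not_eq_true] using measureReal_closed_le hμ ⟨s(u, v), h⟩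

lemma measureReal_not_originOpen_le {ε : ℝ} {μ : Measure (Config plane)}
    (hμ : μ ∈ DGe plane (1 - ε)) : μ.real {ω | ¬ OriginOpen ω} ≤ 3 * ε := by
  have := hμ.1
  let closed (u v : ℤ × ℤ) : Set (Config plane) := {ω | ¬ (openGraph ω).Adj u v}
  have hclosed {u v : ℤ × ℤ} (huv : plane.Adj u v) : μ.real (closed u v) ≤ ε := by
    simpa using measureReal_not_adj_le hμ huv
  have h₁ := hclosed (u := (0, 0)) (v := (1, 0)) (plane_adj_iff.mpr (by simp))
  have h₂ := hclosed (u := (0, 0)) (v := (0, 1)) (plane_adj_iff.mpr (by simp))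
  have h₃ := hclosed (u := (1, 0)) (v := (1, 1)) (plane_adj_iff.mpr (by simp))
  have hsub : {ω : Config plane | ¬ OriginOpen ω} ⊆
      closed (0, 0) (1, 0) ∪ closed (0, 0) (0, 1) ∪ closed (1, 0) (1, 1) := by
    intro ω (hω : ¬ OriginOpen ω)
    simpa only [OriginOpen, not_and_or, closed, Set.mem_union, Set.mem_ofPred_eq, or_assoc] using hω
  linarith [measureReal_mono hsub (μ := μ),
    measureReal_union_le (μ := μ) (closed (0, 0) (1, 0) ∪ closed (0, 0) (0, 1))
      (closed (1, 0) (1, 1)),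
    measureReal_union_le (μ := μ) (closed (0, 0) (1, 0)) (closed (0, 0) (0, 1))]

lemma measurableSet_originOpen : MeasurableSet {ω | OriginOpen ω} := by
  have hadj (u v : ℤ × ℤ) : MeasurableSet {ω : Config plane | (openGraph ω).Adj u v} :=
    edgeEvents_le _ _ (measurableSet_adj (Set.mem_univ u) (Set.mem_univ v))
  exact (hadj _ _).inter ((hadj _ _).inter (hadj _ _))

theorem percolates_of_mem_DGe_plane {μ : Measure (Config plane)}
    (hμ : μ ∈ DGe plane (1 - 1 / 2592)) : Percolates μ := by
  have := hμ.1
  have hbad (j : ℕ) : μ {ω | ¬ OriginOpen (renorm^[j] ω)} ≤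
      ENNReal.ofReal (1 / 432 / 2 / 2 ^ j) := by
    have hmap := measureReal_not_originOpen_le
      (map_renorm_iterate_mem_DGe (by norm_num) le_rfl hμ j)
    have hmeas : MeasurableSet {ω | ¬ OriginOpen ω} := measurableSet_originOpen.compl
    rw [map_measureReal_apply (isLocal_renorm.measurable.iterate j) hmeas] at hmap
    rw [← ofReal_measureReal]
    exact ENNReal.ofReal_le_ofReal (hmap.trans_eq (by ring))
  have hsum := hasSum_geometric_two' (1 / 432)
  set bad : Set (Config plane) := ⋃ j, {ω | ¬ OriginOpen (renorm^[j] ω)}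
  have hlt : μ bad < 1 := by
    calc μ bad ≤ ∑' j : ℕ, ENNReal.ofReal (1 / 432 / 2 / 2 ^ j) :=
          (measure_iUnion_le _).trans (ENNReal.tsum_le_tsum hbad)
      _ = ENNReal.ofReal (1 / 432) := by
        rw [← ENNReal.ofReal_tsum_of_nonneg (fun j ↦ by positivity) hsum.summable, hsum.tsum_eq]
      _ < 1 := ENNReal.ofReal_lt_one.mpr (by norm_num)
  have hgood : badᶜ ⊆ {ω | HasInfiniteComponent (openGraph ω)} := by
    intro ω hω
    simp only [bad, Set.mem_compl_iff, Set.mem_iUnion, Set.mem_ofPred_eq, not_exists,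
      not_not] at hω
    exact hasInfiniteComponent_of_originOpen hω
  calc 0 < 1 - μ bad := tsub_pos_of_lt hlt
    _ ≤ μ badᶜ := tsub_le_iff_left.mpr (by simpa using measure_univ_le_add_compl (μ := μ) bad)
    _ ≤ μ {ω | HasInfiniteComponent (openGraph ω)} := measure_mono hgood

end Renormalization

section Coarse

variable {Y : Type*} {Q : SimpleGraph Y} {P : ℝ} {m : ℕ}

/-- The product of two stars with `m` leaves, the centre of each star being `none`. -/
abbrev starSquare (m : ℕ) : SimpleGraph (Option (Fin m) × Option (Fin m)) :=
  SimpleGraph.starGraph none □ SimpleGraph.starGraph none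

open scoped Classical in
/-- A vertex of `A` among the `(some i, none)`, or the junk value `(none, none)` if there is no
such vertex. -/
noncomputable def hub (A : Set (Option (Fin m) × Option (Fin m))) :
    Option (Fin m) × Option (Fin m) :=
  if h : ∃ i : Fin m, (some i, none) ∈ A then (some h.choose, none) else (none, none)

lemma exists_hub_eq {A : Set (Option (Fin m) × Option (Fin m))}
    (h : ∃ i : Fin m, (some i, none) ∈ A) : ∃ i : Fin m, hub A = (some i, none) ∧ hub A ∈ A :=
  ⟨h.choose, dif_pos h, by
    rw [hub, dif_pos h]
    exact h.choose_spec⟩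

/-- Over `{x} × starSquare m`, the vertices whose copy of `Q` is connected. -/
def rowFibers (ω : Config ((G □ starSquare m) □ Q)) (x : V) :
    Set (Option (Fin m) × Option (Fin m)) :=
  {t | (x, t) ∈ connectedFibers ω}

/-- The hubs over the two vertices of the single edge are joined by open edges. -/
def HubsReachable (c : Y) (ω : Config (((⊤ : SimpleGraph Bool) □ starSquare m) □ Q)) : Prop :=
  (openGraph ω).Reachable ((false, hub (rowFibers ω false)), c)
    ((true, hub (rowFibers ω true)), c)

/-- An edge of `G`, with an arbitrary orientation, as a copy of the complete graph on `Bool`. -/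
noncomputable def edgeHom (e : G.edgeSet) : (⊤ : SimpleGraph Bool) →g G where
  toFun b := bif b then (Quot.out e.1).2 else (Quot.out e.1).1
  map_rel' {a b} h := by
    have hadj : G.Adj (Quot.out e.1).1 (Quot.out e.1).2 := by
      rw [← SimpleGraph.mem_edgeSet]
      convert e.2
      exact Quot.out_eq e.1
    cases a <;> cases b <;> first | exact absurd rfl h | exact hadj | exact hadj.symm

lemma edgeHom_eq (e : G.edgeSet) : s(edgeHom e false, edgeHom e true) = (e : Sym2 V) :=
  Quot.out_eq e.1

/-- The part of `(G □ starSquare m) □ Q` lying over an edge of `G`. -/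
noncomputable def overEdge (m : ℕ) (Q : SimpleGraph Y) (e : G.edgeSet) :
    (((⊤ : SimpleGraph Bool) □ starSquare m) □ Q) →g ((G □ starSquare m) □ Q) :=
  boxProdMap (boxProdMap (edgeHom e) .id) .id

lemma injective_overEdge (e : G.edgeSet) : Function.Injective (overEdge m Q e) :=
  ((SimpleGraph.Hom.injective_of_top_hom _).prodMap Function.injective_id).prodMap
    Function.injective_id

lemma rowFibers_pull_overEdge (e : G.edgeSet) (ω : Config ((G □ starSquare m) □ Q)) (b : Bool) :
    rowFibers (pull (overEdge m Q e) ω) b = rowFibers ω (edgeHom e b) := by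
  ext t
  simp only [rowFibers, connectedFibers, Set.mem_ofPred_eq, pull_pull]
  rfl

open scoped Classical in
/-- The coarse configuration on `G`: an edge is open if the hubs over its two endpoints are joined
by open edges over it. -/
noncomputable def coarse (c : Y) (ω : Config ((G □ starSquare m) □ Q)) : Config G :=
  fun e ↦ decide (HubsReachable c (pull (overEdge m Q e) ω))

lemma isLocal_coarse [Finite Y] (c : Y) :
    IsLocal (coarse (G := G) (m := m) (Q := Q) c) fun x ↦ (fun v ↦ v.1.1) ⁻¹' {x} where
  disjoint _ _ h := (Set.disjoint_singleton.mpr h).preimage _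
  measurable_apply e := by
    have hrange : Set.range (overEdge m Q e) ⊆
        ⋃ x ∈ (e : Sym2 V), (fun v ↦ v.1.1) ⁻¹' {x} := by
      rintro _ ⟨v, rfl⟩
      refine Set.mem_biUnion (x := edgeHom e v.1.1) ?_ rfl
      rw [← edgeHom_eq e]
      cases v.1.1
      · exact Sym2.mem_mk_left _ _
      · exact Sym2.mem_mk_right _ _
    have hlinked := measurable_pull_edgeEvents (overEdge m Q e)
      (MeasurableSet.of_discrete (s := {ω | HubsReachable c ω}))
    exact (measurable_to_bool (by
      simpa [Set.preimage, coarse] using hlinked)).mono (edgeEvents_mono hrange) le_rfl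

lemma reachable_of_adj_coarse {c : Y} {ω : Config ((G □ starSquare m) □ Q)} {x y : V}
    (h : (openGraph (coarse c ω)).Adj x y) :
    (openGraph ω).Reachable ((x, hub (rowFibers ω x)), c) ((y, hub (rowFibers ω y)), c) := by
  classical
  obtain ⟨hadj, hopen⟩ := h
  set e : G.edgeSet := ⟨s(x, y), hadj⟩
  have hhubs : HubsReachable c (pull (overEdge m Q e) ω) := of_decide_eq_true hopen
  have hreach := hhubs.map (openHom (overEdge m Q e) ω)
  rw [rowFibers_pull_overEdge, rowFibers_pull_overEdge] at hreach
  obtain ⟨h0, h1⟩ | ⟨h0, h1⟩ := Sym2.eq_iff.mp (edgeHom_eq e)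
  · rw [← h0, ← h1]
    exact hreach
  · rw [← h0, ← h1]
    exact hreach.symm

lemma hasInfiniteComponent_of_coarse {c : Y} {ω : Config ((G □ starSquare m) □ Q)}
    (h : HasInfiniteComponent (openGraph (coarse c ω))) :
    HasInfiniteComponent (openGraph ω) :=
  h.of_injective (f := fun x ↦ ((x, hub (rowFibers ω x)), c))
    (fun _ _ hxy ↦ congrArg (·.1.1) hxy) fun _ _ ↦ reachable_of_adj_coarse

/-- The inner vertices of a path of length `5` joining `(false, some i, none)` to
`(true, some j, none)`. For fixed `i` and `j` they are disjoint for distinct `r`. -/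
def connector (i j r : Fin m) : Finset (Bool × Option (Fin m) × Option (Fin m)) :=
  {(false, some i, some r), (false, none, some r), (true, none, some r), (true, some j, some r)}

lemma card_connector (i j r : Fin m) : (connector i j r).card = 4 := by
  simp [connector]

lemma pairwise_disjoint_connector (i j : Fin m) :
    Pairwise (Function.onFun Disjoint (connector i j)) := by
  intro r r' h
  simp [Function.onFun, connector, h.symm]

lemma exists_walk_of_connector {i j r : Fin m} {A : Set (Bool × Option (Fin m) × Option (Fin m))}
    (hi : (false, some i, none) ∈ A) (hj : (true, some j, none) ∈ A)
    (hr : ↑(connector i j r) ⊆ A) :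
    ∃ w : ((⊤ : SimpleGraph Bool) □ starSquare m).Walk (false, some i, none) (true, some j, none),
      w.length ≤ 5 ∧ ∀ z ∈ w.support, z ∈ A := by
  have h₁ : ((⊤ : SimpleGraph Bool) □ starSquare m).Adj (false, some i, none)
    (false, some i, some r) := by simp
  have h₂ : ((⊤ : SimpleGraph Bool) □ starSquare m).Adj (false, some i, some r)
    (false, none, some r) := by simp
  have h₃ : ((⊤ : SimpleGraph Bool) □ starSquare m).Adj (false, none, some r)
    (true, none, some r) := by simp
  have h₄ : ((⊤ : SimpleGraph Bool) □ starSquare m).Adj (true, none, some r)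
    (true, some j, some r) := by simp
  have h₅ : ((⊤ : SimpleGraph Bool) □ starSquare m).Adj (true, some j, some r)
    (true, some j, none) := by simp
  refine ⟨.cons h₁ (.cons h₂ (.cons h₃ (.cons h₄ (.cons h₅ .nil)))), le_rfl, ?_⟩
  simp only [connector, Finset.coe_insert, Finset.coe_singleton, Set.insert_subset_iff,
    Set.singleton_subset_iff] at hr
  simp [hi, hj, hr]

variable {μ : Measure (Config (((⊤ : SimpleGraph Bool) □ starSquare m) □ Q))}

lemma measureReal_rowFibers_no_hub_le [Finite Y] (hQ : ConnectedGe Q p P) (hP : 0 ≤ P)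
    (hμ : μ ∈ DGe (((⊤ : SimpleGraph Bool) □ starSquare m) □ Q) p) (b : Bool) :
    μ.real {ω | ∀ i : Fin m, (some i, none) ∉ rowFibers ω b} ≤ (1 - P) ^ m := by
  have h := measureReal_forall_not_subset_connectedFibers_le hQ hP hμ (ι := Fin m)
    (T := fun i ↦ {(b, some i, none)}) (n := 1) (fun i j hij ↦ by simp [Function.onFun, hij])
    fun i ↦ Finset.card_singleton _
  simpa [rowFibers] using h

lemma measureReal_exists_no_connector_le [Finite Y] (hQ : ConnectedGe Q p P) (hP : 0 ≤ P)
    (hμ : μ ∈ DGe (((⊤ : SimpleGraph Bool) □ starSquare m) □ Q) p) :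
    μ.real {ω | ∃ i j : Fin m, ∀ r, ¬ ↑(connector i j r) ⊆ connectedFibers ω} ≤
      m ^ 2 * (1 - P ^ 4) ^ m := by
  have hfixed (ij : Fin m × Fin m) :
      μ.real {ω | ∀ r, ¬ ↑(connector ij.1 ij.2 r) ⊆ connectedFibers ω} ≤ (1 - P ^ 4) ^ m := by
    simpa only [Fintype.card_fin] using measureReal_forall_not_subset_connectedFibers_le hQ hP hμ
      (pairwise_disjoint_connector ij.1 ij.2) (card_connector ij.1 ij.2)
  have hunion : {ω : Config (((⊤ : SimpleGraph Bool) □ starSquare m) □ Q) |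
      ∃ i j : Fin m, ∀ r, ¬ ↑(connector i j r) ⊆ connectedFibers ω} =
      ⋃ ij : Fin m × Fin m, {ω | ∀ r, ¬ ↑(connector ij.1 ij.2 r) ⊆ connectedFibers ω} := by
    ext ω
    simp
  rw [hunion]
  calc _ ≤ ∑ _ : Fin m × Fin m, (1 - P ^ 4) ^ m :=
        (measureReal_iUnion_fintype_le _).trans (Finset.sum_le_sum fun ij _ ↦ hfixed ij)
    _ = m ^ 2 * (1 - P ^ 4) ^ m := by
        simp [sq]

lemma measureReal_not_hubsReachable_le [Finite Y] (hQ : ConnectedGe Q p P) (hP : 0 < P)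
    (hp : p ≤ 1) (hμ : μ ∈ DGe (((⊤ : SimpleGraph Bool) □ starSquare m) □ Q) p) (c : Y) :
    μ.real {ω | ¬ HubsReachable c ω} ≤
      2 * (1 - P) ^ m + m ^ 2 * (1 - P ^ 4) ^ m + 5 * (1 - p) ^ Nat.card Y / P ^ 2 := by
  have := hμ.1
  let NoHub (b : Bool) : Set (Config (((⊤ : SimpleGraph Bool) □ starSquare m) □ Q)) :=
    {ω | ∀ i : Fin m, (some i, none) ∉ rowFibers ω b}
  let NoConnector : Set (Config (((⊤ : SimpleGraph Bool) □ starSquare m) □ Q)) :=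
    {ω | ∃ i j : Fin m, ∀ r, ¬ ↑(connector i j r) ⊆ connectedFibers ω}
  let s (b : Bool) (A : Set (Bool × Option (Fin m) × Option (Fin m))) :
      Bool × Option (Fin m) × Option (Fin m) := (b, hub (Prod.mk b ⁻¹' A))
  have hselect := measureReal_exists_walk_not_reachable_le hQ hP.le hp hμ c (s false) (s true) 5
  set Cut : Set (Config (((⊤ : SimpleGraph Bool) □ starSquare m) □ Q)) := {ω | _ ∧ _}
  have hcover : {ω | ¬ HubsReachable c ω} ⊆ NoHub false ∪ NoHub true ∪ NoConnector ∪ Cut := by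
    intro ω hω
    by_contra! hnot
    simp only [Set.mem_union, not_or, NoHub, NoConnector, Set.mem_ofPred_eq, not_forall, not_exists,
      not_not] at hnot
    obtain ⟨⟨⟨h₀, h₁⟩, hconn⟩, hcut⟩ := hnot
    obtain ⟨i, hi, hi'⟩ := exists_hub_eq h₀
    obtain ⟨j, hj, hj'⟩ := exists_hub_eq h₁
    obtain ⟨r, hr⟩ := hconn i j
    rw [hi] at hi'
    rw [hj] at hj'
    obtain ⟨w, hw⟩ := exists_walk_of_connector (A := connectedFibers ω) hi' hj' hr
    exact hcut ⟨⟨w.copy (congrArg (Prod.mk false) hi.symm) (congrArg (Prod.mk true) hj.symm),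
      by simpa only [SimpleGraph.Walk.length_copy, SimpleGraph.Walk.support_copy] using hw⟩, hω⟩
  have hCut : μ.real Cut ≤ 5 * (1 - p) ^ Nat.card Y / P ^ 2 :=
    (le_div_iff₀' (pow_pos hP 2)).mpr (by exact_mod_cast hselect)
  have hNoHub (b : Bool) : μ.real (NoHub b) ≤ (1 - P) ^ m :=
    measureReal_rowFibers_no_hub_le hQ hP.le hμ b
  have hNoConnector : μ.real NoConnector ≤ m ^ 2 * (1 - P ^ 4) ^ m :=
    measureReal_exists_no_connector_le hQ hP.le hμ
  have hunion₁ := measureReal_union_le (μ := μ) (NoHub false) (NoHub true)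
  have hunion₂ := measureReal_union_le (μ := μ) (NoHub false ∪ NoHub true) NoConnector
  have hunion₃ := measureReal_union_le (μ := μ) (NoHub false ∪ NoHub true ∪ NoConnector) Cut
  linarith [measureReal_mono (μ := μ) hcover, hNoHub false, hNoHub true]

lemma map_coarse_mem_DGe [Finite Y] (c : Y) {ε : ℝ}
    (h : ∀ ν ∈ DGe (((⊤ : SimpleGraph Bool) □ starSquare m) □ Q) p,
      ν.real {ω | ¬ HubsReachable c ω} ≤ ε)
    {μ : Measure (Config ((G □ starSquare m) □ Q))} (hμ : μ ∈ DGe ((G □ starSquare m) □ Q) p) :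
    μ.map (coarse c) ∈ DGe G (1 - ε) := by
  refine (isLocal_coarse c).map_mem_DGe hμ fun e ↦ ?_
  have hν := map_pull_mem_DGe (injective_overEdge e) hμ
  have := hν.1
  have hle := h _ hν
  have hcompl : {ω : Config (((⊤ : SimpleGraph Bool) □ starSquare m) □ Q) |
      ¬ HubsReachable c ω} = {ω | HubsReachable c ω}ᶜ := rfl
  rw [hcompl, probReal_compl_eq_one_sub .of_discrete,
    map_measureReal_apply (isLocal_pull (injective_overEdge e)).measurable .of_discrete] at hle
  simpa [coarse, add_comm] using hle

theorem exists_starSquare_forall_percolates [Finite Y] [Nonempty Y] (hQ : ConnectedGe Q p P)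
    (hP : 0 < P) (hp : p ≤ 1) (hcut : 10 * 2592 * (1 - p) ^ Nat.card Y ≤ P ^ 2) :
    ∃ m, ∀ μ ∈ DGe ((plane □ starSquare m) □ Q) p, Percolates μ := by
  obtain ⟨c⟩ := ‹Nonempty Y›
  by_contra! hnot
  have hP1 : P ≤ 1 := by
    obtain ⟨μ, hμ, -⟩ := hnot 0
    have := hμ.1
    exact (le_measureReal_mem_connectedFibers hQ hμ (0, none, none)).trans measureReal_le_one
  have hlim : Tendsto (fun m : ℕ ↦ 2 * (1 - P) ^ m + m ^ 2 * (1 - P ^ 4) ^ m) atTop (𝓝 0) := by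
    have hP4 : P ^ 4 ≤ 1 := pow_le_one₀ hP.le hP1
    have hhub := (tendsto_pow_atTop_nhds_zero_of_lt_one (sub_nonneg.mpr hP1)
      (sub_lt_self 1 hP)).const_mul 2
    have hconn := tendsto_pow_const_mul_const_pow_of_lt_one 2 (sub_nonneg.mpr hP4)
      (sub_lt_self 1 (pow_pos hP 4))
    simpa using hhub.add hconn
  obtain ⟨m, hm⟩ := (hlim.eventually_lt_const (show (0 : ℝ) < 1 / 5184 by norm_num)).exists
  have hcut' : 5 * (1 - p) ^ Nat.card Y / P ^ 2 ≤ 1 / 5184 :=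
    (div_le_iff₀ (pow_pos hP 2)).mpr (by linarith)
  obtain ⟨μ, hμ, hμ'⟩ := hnot m
  refine hμ' (.of_map (isLocal_coarse c).measurable (fun _ ↦ hasInfiniteComponent_of_coarse)
    (percolates_of_mem_DGe_plane (map_coarse_mem_DGe c (fun ν hν ↦ ?_) hμ)))
  linarith [measureReal_not_hubsReachable_le hQ hP hp hν c]

end Coarse

section Lattice

lemma boxProd_isContained_lattice_add {m n : ℕ} (hG : G ⊑ lattice m) (hH : H ⊑ lattice n) :
    (G □ H) ⊑ lattice (m + n) := by
  obtain ⟨φ⟩ := hG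
  obtain ⟨ψ⟩ := hH
  refine ⟨⟨⟨fun x ↦ Fin.append (φ x.1) (ψ x.2), ?_⟩, ?_⟩⟩
  · rintro ⟨u, v⟩ ⟨u', v'⟩ (⟨hadj, rfl⟩ | ⟨hadj, rfl⟩)
    · obtain ⟨i, hi, heq⟩ := φ.toHom.map_adj hadj
      refine ⟨Fin.castAdd n i, by simpa using hi, fun j hj ↦ ?_⟩
      cases j using Fin.addCases with
      | left j => simpa using heq j (by simpa using hj)
      | right j => simp
    · obtain ⟨i, hi, heq⟩ := ψ.toHom.map_adj hadj
      refine ⟨Fin.natAdd m i, by simpa using hi, fun j hj ↦ ?_⟩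
      cases j using Fin.addCases with
      | left j => simp
      | right j => simpa using heq j (by simpa using hj)
  · intro x y h
    have heq : (φ x.1, ψ x.2) = (φ y.1, ψ y.2) := (Fin.appendEquiv m n).injective h
    exact Prod.ext (φ.injective (congrArg Prod.fst heq)) (ψ.injective (congrArg Prod.snd heq))

lemma lattice_isContained_of_le {m n : ℕ} (h : m ≤ n) : lattice m ⊑ lattice n := by
  obtain ⟨k, rfl⟩ := Nat.exists_eq_add_of_le h
  exact .trans ⟨((lattice m).boxProdLeft (lattice k) 0).toCopy⟩
    (boxProd_isContained_lattice_add .rfl .rfl)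

lemma hasse_int_isContained_lattice : SimpleGraph.hasse ℤ ⊑ lattice 1 := by
  refine ⟨⟨⟨fun x _ ↦ x, ?_⟩, fun _ _ h ↦ congrFun h 0⟩⟩
  intro x y h
  refine ⟨0, ?_, fun j hj ↦ absurd (Subsingleton.elim j 0) hj⟩
  rw [SimpleGraph.hasse_adj, Order.covBy_iff_add_one_eq, Order.covBy_iff_add_one_eq] at h
  change |x - y| = 1
  rw [abs_eq zero_le_one]
  omega

lemma starGraph_isContained_lattice (m : ℕ) :
    SimpleGraph.starGraph (none : Option (Fin m)) ⊑ lattice m := by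
  let f (x : Option (Fin m)) : Fin m → ℤ := x.elim 0 fun i ↦ Pi.single i 1
  have hadj (i : Fin m) : (lattice m).Adj (f none) (f (some i)) :=
    ⟨i, by simp [f], fun j hj ↦ by simp [f, hj]⟩
  refine ⟨⟨⟨f, ?_⟩, ?_⟩⟩
  · rintro (_ | i) (_ | j) h
    · exact absurd rfl h.ne
    · exact hadj j
    · exact (hadj i).symm
    · simp at h
  · rintro (_ | i) (_ | j) h
    · rfl
    · exact absurd h (hadj j).ne
    · exact absurd h (hadj i).ne'
    · have hi : f (some i) i = f (some j) i := congrFun h i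
      simpa [f, Pi.single_apply] using hi

lemma cube_isContained_lattice (k : ℕ) : cube k ⊑ lattice k := by
  have htoInt (a b : Bool) (h : a ≠ b) : |a.toInt - b.toInt| = 1 := by
    cases a <;> cases b <;> simp_all
  refine ⟨⟨⟨fun x i ↦ (x i).toInt, ?_⟩, ?_⟩⟩
  · rintro x y ⟨i, hi, huniq⟩
    exact ⟨i, htoInt _ _ hi, fun j hj ↦ congrArg Bool.toInt (not_not.mp fun h ↦ hj (huniq j h))⟩
  · intro x y h
    funext i
    have hi : (x i).toInt = (y i).toInt := congrFun h i
    revert hi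
    cases x i <;> cases y i <;> simp

lemma exists_lattice_forall_percolates {k : ℕ} {P : ℝ} (hQ : ConnectedGe (cube k) p P)
    (hP : 0 < P) (hp : p ≤ 1) (hcut : 10 * 2592 * (1 - p) ^ 2 ^ k ≤ P ^ 2) :
    ∃ n, ∀ μ ∈ DGe (lattice n) p, Percolates μ := by
  obtain ⟨m, hm⟩ := exists_starSquare_forall_percolates hQ hP hp (by simpa using hcut)
  have hplane := boxProd_isContained_lattice_add hasse_int_isContained_lattice
    hasse_int_isContained_lattice
  have hstar := boxProd_isContained_lattice_add (starGraph_isContained_lattice m)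
    (starGraph_isContained_lattice m)
  exact ⟨_, fun μ ↦ percolates_of_isContained (boxProd_isContained_lattice_add
    (boxProd_isContained_lattice_add hplane hstar) (cube_isContained_lattice k)) hm⟩

lemma exists_tendsto_pMax_lattice_le {n : ℕ} (hp : 0 ≤ p)
    (h : ∀ μ ∈ DGe (lattice n) p, Percolates μ) :
    ∃ L, Tendsto (fun n ↦ pMax (lattice n)) atTop (𝓝 L) ∧ L ≤ p := by
  have hanti : Antitone fun n ↦ pMax (lattice n) :=
    fun _ _ hmn ↦ pMax_anti (lattice_isContained_of_le hmn)
  have hbdd : BddBelow (Set.range fun n ↦ pMax (lattice n)) :=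
    ⟨0, Set.forall_mem_range.mpr fun n ↦ pMax_nonneg (lattice n)⟩
  exact ⟨_, tendsto_atTop_ciInf hanti hbdd, (ciInf_le hbdd n).trans (pMax_le hp h)⟩

end Lattice

end Percolation

theorem theorem1p4 (p : ℝ) (hp₀ : 0 < p) (hp₁ : p ≤ 1) (k : ℕ) (hk : 1 ≤ k) (P : ℝ)
    (hP : (1 - p) ^ (2 ^ (k - 1)) * Real.goldenRatio < P)
    (hconn : ∀ μ ∈ Percolation.DGe (Percolation.cube k) p,
      P ≤ μ.real {ω | (Percolation.openGraph ω).Connected}) :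
    (∃ N : ℕ, ∀ n ≥ N, ∀ μ ∈ Percolation.DGe (Percolation.lattice n) p,
      Percolation.Percolates μ) ∧
    ∃ L : ℝ, Tendsto (fun n : ℕ => Percolation.pMax (Percolation.lattice n)) atTop (𝓝 L) ∧
      L ≤ p := by
  obtain ⟨k', P', hP', hcut, hcube⟩ :=
    Percolation.ConnectedGe.exists_cube_mul_le hk hp₁ hP hconn (10 * 2592)
  obtain ⟨N, hN⟩ := Percolation.exists_lattice_forall_percolates hcube hP' hp₁ hcut
  exact ⟨⟨N, fun n hn μ ↦ Percolation.percolates_of_isContained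
      (Percolation.lattice_isContained_of_le hn) hN⟩,
    Percolation.exists_tendsto_pMax_lattice_le hp₀.le hN⟩
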